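/- Let $G$ be a group, let $A$ be a group with a homomorphism $A\to\mathrm{Aut}(G)$ whose image is normalized by $\mathrm{Inn}(G)$. Define normal $A$-invariant subgroups $Z_\alpha(G,A)$ of $G$ for all ordinals $\alpha$ by $Z_0(G,A)=1$, $Z_{\alpha+1}(G,A)/Z_\alpha(G,A)=C_{G/Z_\alpha(G,A)}(A)$ (the subgroup of elements of the quotient fixed by $A$), and $Z_\lambda(G,A)=\bigcup_{\alpha<\lambda}Z_\alpha(G,A)$ for limit ordinals $\lambda$. The last term $Z_\infty(G,A)$ of this ascending series is the $A$-hypercenter of $G$, and $G$ is $A$-hypercentral if $G=Z_\alpha(G,A)$ for some ordinal $\alpha$. The hypercenter of a group $H$ is $Z_\infty(H,H)$ for the action of $H$ on itself by conjugation. If $L$ is a normal $A$-invariant subgroup of $G$, then $A$ acts on $G/L$ by the induced action, whose image is again normalized by $\mathrm{Inn}(G/L)$. **Theorem 2.** There are functions $f,h:\mathbb N\times\mathbb N\to\mathbb N$ such that the following holds. Let $G$ be a group and let $A\le\mathrm{Aut}(G)$ be a subgroup that is normalized by $\mathrm{Inn}(G)$ and such that the hypercenter of $A/(A\cap\mathrm{Inn}(G))$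 has finite index $k$. (B) If the $A$-hypercenter of $G$ has finite index $t$ in $G$, then there is a finite normal $A$-invariant subgroup $L$ of $G$ of order $|L|\le f(t,k)$ such that $G/L$ is $A$-hypercentral. (H) If there is a finite normal $A$-invariant subgroup $L$ of $G$ of order $d$ such that $G/L$ is $A$-hypercentral, then the $A$-hypercenter of $G$ has finite index at most $h(d,k)$ in $G$. -/

import Mathlib

universe u v w

noncomputable section

namespace ActionHypercenter

/-- The group `Inn(G)` of inner automorphisms, as a subgroup of `Aut(G)`. -/
def inn (G : Type u) [Group G] : Subgroup (MulAut G) :=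
  (MulAut.conj : G →* MulAut G).range

instance inn_normal (G : Type u) [Group G] : (inn G).Normal where
  conj_mem := by
    rintro _ ⟨g, rfl⟩ a
    exact ⟨a g, by ext x; simp⟩

section Action

variable {G : Type u} [Group G] {B : Type v} [Group B]

/-- The image of the action `φ : B → Aut(G)` is normalized by `Inn(G)`. -/
def NormalizedByInn (φ : B →* MulAut G) : Prop :=
  inn G ≤ Subgroup.normalizer (φ.range : Set (MulAut G))

/-- `N` is a `B`-subgroup: it is mapped into itself by every element of `B`
(hence onto itself, as `B` is a group). -/
def IsInvariant (φ : B →* MulAut G) (N : Subgroup G) : Prop :=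
  ∀ b : B, ∀ x ∈ N, φ b x ∈ N

theorem IsInvariant.map_eq {φ : B →* MulAut G} {N : Subgroup G} (h : IsInvariant φ N) (b : B) :
    N.map ((φ b : G ≃* G) : G →* G) = N := by
  ext x
  constructor
  · rintro ⟨y, hy, rfl⟩
    exact h b y hy
  · intro hx
    exact ⟨φ b⁻¹ x, h b⁻¹ x hx, by simp⟩

/-- The action induced on the quotient by a normal `B`-subgroup: `b • gN = (b • g)N`. -/
def quotientAction (φ : B →* MulAut G) (N : Subgroup G) [N.Normal] (h : IsInvariant φ N) :
    B →* MulAut (G ⧸ N) where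
  toFun b := QuotientGroup.congr N N (φ b) (h.map_eq b)
  map_one' := by
    ext x
    induction x using QuotientGroup.induction_on with
    | H g => simp
  map_mul' a b := by
    ext x
    induction x using QuotientGroup.induction_on with
    | H g => simp

@[simp]
theorem quotientAction_mk (φ : B →* MulAut G) (N : Subgroup G) [N.Normal] (h : IsInvariant φ N)
    (b : B) (g : G) : quotientAction φ N h b (g : G ⧸ N) = (φ b g : G) := rfl

theorem NormalizedByInn.exists_conj {φ : B →* MulAut G} (hφ : NormalizedByInn φ) (g : G) (b : B) :
    ∃ c : B, ∀ x : G, φ c x = g * φ b (g⁻¹ * x * g) * g⁻¹ := by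
  obtain ⟨c, hc⟩ := (hφ ⟨g, rfl⟩ (φ b)).1 ⟨b, rfl⟩
  exact ⟨c, fun x => by rw [hc]; simp [MulAut.mul_apply]⟩

theorem NormalizedByInn.of_exists_conj {φ : B →* MulAut G}
    (hφ : ∀ (g : G) (b : B), ∃ c : B, ∀ x : G, φ c x = g * φ b (g⁻¹ * x * g) * g⁻¹) :
    NormalizedByInn φ := by
  have key : ∀ (g : G) (f : MulAut G), f ∈ φ.range →
      MulAut.conj g * f * (MulAut.conj g)⁻¹ ∈ φ.range := by
    rintro g _ ⟨b, rfl⟩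
    obtain ⟨c, hc⟩ := hφ g b
    exact ⟨c, by ext x; rw [hc]; simp [MulAut.mul_apply]⟩
  rintro _ ⟨g, rfl⟩ f
  refine ⟨key g f, fun h => ?_⟩
  have := key g⁻¹ _ h
  simpa [mul_assoc] using this

theorem NormalizedByInn.quotientAction {φ : B →* MulAut G} (hφ : NormalizedByInn φ)
    (N : Subgroup G) [N.Normal] (h : IsInvariant φ N) :
    NormalizedByInn (quotientAction φ N h) := by
  refine NormalizedByInn.of_exists_conj fun q b => ?_
  induction q using QuotientGroup.induction_on with
  | H g =>
    obtain ⟨c, hc⟩ := hφ.exists_conj g b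
    refine ⟨c, fun x => ?_⟩
    induction x using QuotientGroup.induction_on with
    | H x => exact congrArg (QuotientGroup.mk (s := N)) (hc x)

theorem normalizedByInn_conj (G : Type u) [Group G] :
    NormalizedByInn (MulAut.conj : G →* MulAut G) :=
  NormalizedByInn.of_exists_conj fun g b => ⟨g * b * g⁻¹, fun x => by simp [mul_assoc]⟩

/-- The centralizer `C_G(B)` in `G` of an action of `B` on `G`. -/
def fixedSubgroup (φ : B →* MulAut G) : Subgroup G where
  carrier := {g | ∀ b, φ b g = g}
  mul_mem' hx hy b := by rw [map_mul, hx b, hy b]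
  one_mem' b := map_one _
  inv_mem' hx b := by rw [map_inv, hx b]

/-- The normal `B`-subgroups of `G`. -/
structure NormalInvariant (φ : B →* MulAut G) where
  toSubgroup : Subgroup G
  normal : toSubgroup.Normal
  invariant : IsInvariant φ toSubgroup

/-- The full preimage in `G` of `C_{G/N}(B)`. -/
def centerStep (φ : B →* MulAut G) (N : NormalInvariant φ) : Subgroup G :=
  haveI := N.normal
  (fixedSubgroup (quotientAction φ N.toSubgroup N.invariant)).comap
    (QuotientGroup.mk' N.toSubgroup)

theorem mem_centerStep (φ : B →* MulAut G) (N : NormalInvariant φ) (g : G) :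
    g ∈ centerStep φ N ↔ ∀ b, g⁻¹ * φ b g ∈ N.toSubgroup := by
  have := N.normal
  refine forall_congr' fun b => ?_
  change ((φ b g : G) : G ⧸ N.toSubgroup) = (g : G ⧸ N.toSubgroup) ↔ _
  rw [eq_comm, QuotientGroup.eq]

/-- The full preimage of `C_{G/N}(B)`, as a normal `B`-subgroup. -/
def nextCenter (φ : B →* MulAut G) (hφ : NormalizedByInn φ) (N : NormalInvariant φ) :
    NormalInvariant φ where
  toSubgroup := centerStep φ N
  normal := by
    have := N.normal
    refine ⟨fun g hg x => ?_⟩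
    rw [mem_centerStep] at hg ⊢
    intro b
    obtain ⟨c, hc⟩ := hφ.exists_conj x⁻¹ b
    have h1 := N.normal.conj_mem _ (hg c) x
    rw [hc] at h1
    simpa [mul_assoc] using h1
  invariant := by
    intro c g hg
    rw [mem_centerStep] at hg ⊢
    intro b
    have h1 := N.invariant c _ (hg (c⁻¹ * b * c))
    simpa [MulAut.mul_apply] using h1

/-- The trivial subgroup as a normal `B`-subgroup. -/
def trivialSubgroup (φ : B →* MulAut G) : NormalInvariant φ where
  toSubgroup := ⊥
  normal := inferInstance
  invariant b x hx := by
    rw [Subgroup.mem_bot] at hx ⊢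
    rw [hx, map_one]

/-- The subgroup generated by a family of normal `B`-subgroups
(the union, in the case of a nonempty chain). -/
def supSubgroup {φ : B →* MulAut G} {ι : Sort w} (N : ι → NormalInvariant φ) :
    NormalInvariant φ where
  toSubgroup := ⨆ i, (N i).toSubgroup
  normal := by
    have := fun i => (N i).normal
    infer_instance
  invariant b := by
    change (⨆ i, (N i).toSubgroup) ≤ (⨆ i, (N i).toSubgroup).comap ((φ b : G ≃* G) : G →* G)
    exact iSup_le fun i x hx =>
      (le_iSup (fun i => (N i).toSubgroup) i) ((N i).invariant b x hx)

/-- The ascending series `Z_α(G,B)` of `α`-th `B`-centers of `G`: `Z_0 = 1`,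
`Z_{α+1}/Z_α = C_{G/Z_α}(B)`, and `Z_λ = ⋃_{α<λ} Z_α` for a limit ordinal `λ`. -/
def centerSeries (φ : B →* MulAut G) (hφ : NormalizedByInn φ) (α : Ordinal.{w}) :
    NormalInvariant φ :=
  Ordinal.limitRecOn α (trivialSubgroup φ) (fun _ N => nextCenter φ hφ N)
    (fun l _ N => supSubgroup fun β : Set.Iio l => N β.1 β.2)

/-- The `B`-hypercenter `Z_∞(G,B)`, the last term of the ascending series `Z_α(G,B)`, that is,
the union of all its terms. The ordinals of the universe of `G` suffice for the series to
become stationary. -/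
def actionHypercenter (φ : B →* MulAut G) (hφ : NormalizedByInn φ) : Subgroup G :=
  ⨆ α : Ordinal.{u}, (centerSeries φ hφ α).toSubgroup

/-- `G` is `B`-hypercentral: `G = Z_α(G,B)` for some ordinal `α`. -/
def IsActionHypercentral (φ : B →* MulAut G) (hφ : NormalizedByInn φ) : Prop :=
  ∃ α : Ordinal.{u}, (centerSeries φ hφ α).toSubgroup = ⊤

end Action

/-- The hypercenter of a group: the last term of its transfinite upper central series,
obtained from the action of the group on itself by conjugation. -/
def hypercenter (G : Type u) [Group G] : Subgroup G :=
  actionHypercenter (MulAut.conj : G →* MulAut G) (normalizedByInn_conj G)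

end ActionHypercenter

end

open ActionHypercenter

/-! Write `[g, a] = g⁻¹ * a g`. Ordinals are traded for well-founded induction: `g` lies in the
hypercenter `Z` iff every iterated commutator sequence from `g` reaches `1`, and `G/L` is
hypercentral iff every `g` reaches `L` (`Reaches`). Normalization by `Inn(G)` enters mostly through
one fact: conjugation by `[g, a]` is itself induced by an element of the acting group.

(H) Modulo `Z` the action has no nontrivial fixed points, so `g` is determined by the map `a ↦ [g,
a]`. Let `C = C_G(L)`, and let `E` be the elements of `A` that fix `L` pointwise and are
hypercentral modulo inner automorphisms. Then `E` acts trivially on `C` (`fixes_centralizer`), so on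
`C` the map `a ↦ [g, a]` factors through the finite set `A/E`. This bounds the number of elements of
each commutator depth over `L` (`card_depth_le`). The depth itself is bounded because each `[g, a]`
with `g ∈ C` generates, with its `A`-images, a finite abelian group of bounded order
(`card_le_of_no_fixed_points`).

(B) Let `T ≥ Z` be a smallest normal `A`-subgroup with hypercentral quotient; then `T = [T, A] Z`.
Hence coset representatives `x i` of `Z` in `T` satisfy, modulo `Z`, a finite system `x i = w i (x)`
of words in commutators. Such words contract along the central series, so the system has exactly one
solution `l` in the given cosets. Uniqueness makes `l` rigid: `Z` and a subgroup of bounded index in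
`A` fix it. The normal `A`-closure `L` of `l` therefore has boundedly many generators and
centralizes `Z`. Schur's theorem bounds `[L, L]`, and the same contraction puts `(l i) ^ t` in `[L,
L]`, so `L` is finite. The subgroup of `A` needed here comes from the argument of (H) applied to
conjugation inside `A` (`index_hypercenter_le`). -/

namespace ActionHypercenter

/-! ### The central series and commutator sequences -/

section Series

variable {G : Type u} [Group G] {B : Type v} [Group B]

/-- Every sequence of commutators `g`, `[g, b₁]`, `[g, b₁, b₂]`, … with entries in `B` eventually
meets `S`. -/
inductive Reaches (φ : B →* MulAut G) (S : Set G) : G → Prop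
  | base {g : G} : g ∈ S → Reaches φ S g
  | step {g : G} : (∀ b, Reaches φ S (g⁻¹ * φ b g)) → Reaches φ S g

theorem Reaches.trans {φ : B →* MulAut G} {S S' : Set G} {g : G} (h : Reaches φ S g)
    (hS : ∀ x ∈ S, Reaches φ S' x) : Reaches φ S' g := by
  induction h with
  | base hg => exact hS _ hg
  | step _ ih => exact .step ih

theorem Reaches.mem_of_closed {φ : B →* MulAut G} {S : Set G} {N : Set G} {g : G}
    (h : Reaches φ S g) (hS : S ⊆ N) (hN : ∀ x : G, (∀ b, x⁻¹ * φ b x ∈ N) → x ∈ N) : g ∈ N := by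
  induction h with
  | base hg => exact hS hg
  | step _ ih => exact hN _ ih

/-- Translating by elements of `L` does not affect reaching `L`. -/
theorem Reaches.mul_left {φ : B →* MulAut G} {L : Subgroup G} [hn : L.Normal]
    (hL : IsInvariant φ L) {z : G} (h : Reaches φ {1} z) :
    ∀ l ∈ L, Reaches φ L (l * z) := by
  induction h with
  | base hg =>
    intro l hl
    rw [Set.mem_singleton_iff.1 hg, mul_one]
    exact .base hl
  | @step z _ ih =>
    intro l hl
    refine .step fun b => ?_
    have h1 : z⁻¹ * (l⁻¹ * φ b l) * z ∈ L := by
      simpa using hn.conj_mem _ (L.mul_mem (L.inv_mem hl) (hL b l hl)) z⁻¹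
    have h2 : (l * z)⁻¹ * φ b (l * z) = z⁻¹ * (l⁻¹ * φ b l) * z * (z⁻¹ * φ b z) := by
      rw [map_mul]; group
    rw [h2]
    exact ih b _ h1

variable (φ : B →* MulAut G) (hφ : NormalizedByInn φ)

theorem centerSeries_zero : (centerSeries φ hφ (0 : Ordinal.{w})).toSubgroup = ⊥ := by
  rw [centerSeries, Ordinal.limitRecOn_zero]; rfl

theorem mem_centerSeries_succ (α : Ordinal.{w}) (g : G) :
    g ∈ (centerSeries φ hφ (α + 1)).toSubgroup ↔
      ∀ b, g⁻¹ * φ b g ∈ (centerSeries φ hφ α).toSubgroup := by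
  rw [centerSeries, Ordinal.limitRecOn_add_one]
  exact mem_centerStep φ _ g

theorem centerSeries_limit {l : Ordinal.{w}} (hl : Order.IsSuccLimit l) :
    (centerSeries φ hφ l).toSubgroup =
      ⨆ β : Set.Iio l, (centerSeries φ hφ β.1).toSubgroup := by
  rw [centerSeries, Ordinal.limitRecOn_limit _ _ _ _ hl]; rfl

theorem centerSeries_mono {α β : Ordinal.{w}} (h : α ≤ β) :
    (centerSeries φ hφ α).toSubgroup ≤ (centerSeries φ hφ β).toSubgroup := by
  induction β using Ordinal.limitRecOn with
  | zero => rw [nonpos_iff_eq_zero.1 h]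
  | add_one β ih =>
    rcases h.eq_or_lt with rfl | h
    · rfl
    · refine (ih (Order.lt_add_one_iff.1 h)).trans fun g hg => ?_
      rw [mem_centerSeries_succ]
      exact fun b => mul_mem (inv_mem hg) ((centerSeries φ hφ β).invariant b g hg)
  | limit l hl ih =>
    rcases h.eq_or_lt with rfl | h
    · rfl
    · rw [centerSeries_limit φ hφ hl]
      exact le_iSup (fun β : Set.Iio l => (centerSeries φ hφ β.1).toSubgroup) ⟨α, h⟩

theorem mem_centerSeries_limit {l : Ordinal.{w}} (hl : Order.IsSuccLimit l) (g : G) :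
    g ∈ (centerSeries φ hφ l).toSubgroup ↔
      ∃ β < l, g ∈ (centerSeries φ hφ β).toSubgroup := by
  rw [centerSeries_limit φ hφ hl]
  have : Nonempty (Set.Iio l) := ⟨⟨0, hl.bot_lt⟩⟩
  rw [Subgroup.mem_iSup_of_directed]
  · simp
  · exact Monotone.directed_le fun a b hab => centerSeries_mono φ hφ hab

/-- Each element of the hypercenter appears at some ordinal, and the supremum of these over `G`
stays in the universe of `G`. -/
theorem exists_centerSeries_eq :
    ∃ α : Ordinal.{u}, (centerSeries φ hφ α).toSubgroup = actionHypercenter φ hφ := by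
  have hmem : ∀ g : G, g ∈ actionHypercenter φ hφ →
      ∃ α : Ordinal.{u}, g ∈ (centerSeries φ hφ α).toSubgroup := fun g hg =>
    (Subgroup.mem_iSup_of_directed
      (Monotone.directed_le fun a b hab => centerSeries_mono φ hφ hab)).1 hg
  choose! a ha using hmem
  refine ⟨⨆ g : G, a g, le_antisymm
    (le_iSup (fun α : Ordinal.{u} => (centerSeries φ hφ α).toSubgroup) _) fun g hg => ?_⟩
  exact centerSeries_mono φ hφ (Ordinal.le_iSup a g) (ha g hg)

theorem actionHypercenter_normal : (actionHypercenter φ hφ).Normal := by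
  obtain ⟨α, hα⟩ := exists_centerSeries_eq φ hφ
  rw [← hα]
  exact (centerSeries φ hφ α).normal

theorem actionHypercenter_invariant : IsInvariant φ (actionHypercenter φ hφ) := by
  obtain ⟨α, hα⟩ := exists_centerSeries_eq φ hφ
  rw [← hα]
  exact (centerSeries φ hφ α).invariant

theorem mem_actionHypercenter_of_forall {g : G}
    (h : ∀ b, g⁻¹ * φ b g ∈ actionHypercenter φ hφ) : g ∈ actionHypercenter φ hφ := by
  obtain ⟨α, hα⟩ := exists_centerSeries_eq φ hφ
  rw [← hα] at h
  exact (le_iSup (fun α : Ordinal.{u} => (centerSeries φ hφ α).toSubgroup) (α + 1))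
    ((mem_centerSeries_succ φ hφ α g).2 h)

theorem reaches_of_mem_centerSeries (α : Ordinal.{w}) :
    ∀ g ∈ (centerSeries φ hφ α).toSubgroup, Reaches φ {1} g := by
  induction α using Ordinal.limitRecOn with
  | zero =>
    intro g hg
    rw [centerSeries_zero, Subgroup.mem_bot] at hg
    exact .base hg
  | add_one α ih =>
    intro g hg
    exact .step fun b => ih _ ((mem_centerSeries_succ φ hφ α g).1 hg b)
  | limit l hl ih =>
    intro g hg
    obtain ⟨β, hβ, hg⟩ := (mem_centerSeries_limit φ hφ hl g).1 hg
    exact ih β hβ g hg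

/-- This replaces transfinite induction by induction along commutators. The converse holds because
the hypercenter contains every element whose commutators it contains. -/
theorem mem_actionHypercenter_iff {g : G} :
    g ∈ actionHypercenter φ hφ ↔ Reaches φ {1} g := by
  constructor
  · obtain ⟨α, hα⟩ := exists_centerSeries_eq φ hφ
    rw [← hα]
    exact reaches_of_mem_centerSeries φ hφ α g
  · intro h
    refine h.mem_of_closed (N := (actionHypercenter φ hφ : Set G)) ?_
      fun x hx => mem_actionHypercenter_of_forall φ hφ hx
    rintro _ rfl
    exact one_mem _

theorem isActionHypercentral_iff :
    IsActionHypercentral φ hφ ↔ ∀ g, Reaches φ {1} g := by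
  constructor
  · rintro ⟨α, hα⟩ g
    exact reaches_of_mem_centerSeries φ hφ α g (hα ▸ Subgroup.mem_top g)
  · intro h
    obtain ⟨α, hα⟩ := exists_centerSeries_eq φ hφ
    exact ⟨α, hα.trans (eq_top_iff.2 fun g _ => (mem_actionHypercenter_iff φ hφ).2 (h g))⟩

variable {φ}

theorem reaches_quotient_iff (L : Subgroup G) [L.Normal] (hL : IsInvariant φ L) (g : G) :
    Reaches (quotientAction φ L hL) {1} (g : G ⧸ L) ↔ Reaches φ L g := by
  constructor
  · intro h
    generalize hq : (g : G ⧸ L) = q at h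
    induction h generalizing g with
    | base h =>
      rw [Set.mem_singleton_iff.1 h, QuotientGroup.eq_one_iff] at hq
      exact .base hq
    | step _ ih =>
      subst hq
      exact .step fun b => ih b _ rfl
  · intro h
    induction h with
    | base h => exact .base ((QuotientGroup.eq_one_iff _).2 h)
    | step _ ih => exact .step ih

theorem isActionHypercentral_quotient_iff (L : Subgroup G) [L.Normal] (hL : IsInvariant φ L) :
    IsActionHypercentral (quotientAction φ L hL) (hφ.quotientAction L hL) ↔
      ∀ g, Reaches φ L g := by
  rw [isActionHypercentral_iff]
  constructor
  · exact fun h g => (reaches_quotient_iff L hL g).1 (h g)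
  · intro h q
    induction q using QuotientGroup.induction_on with
    | H g => exact (reaches_quotient_iff L hL g).2 (h g)

/-- `[G, B]` induces inner automorphisms lying in the image of `B`. -/
theorem NormalizedByInn.exists_eq_conj_commutator (hφ : NormalizedByInn φ) (g : G) (a : B) :
    ∃ b, φ b = MulAut.conj (g⁻¹ * φ a g) := by
  obtain ⟨c, hc⟩ := hφ.exists_conj g⁻¹ a
  refine ⟨c * a⁻¹, ?_⟩
  ext x
  rw [map_mul, MulAut.mul_apply, hc]
  simp [mul_assoc]

end Series

/-! ### Elementary counting bounds -/

theorem index_le_card_of_map {A : Type*} [Group A] {X : Type*} [Finite X] (C : Subgroup A)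
    (f : A → X) (hf : ∀ a b, f a = f b → a⁻¹ * b ∈ C) :
    C.FiniteIndex ∧ C.index ≤ Nat.card X := by
  have hinj : Function.Injective fun q : A ⧸ C => f q.out := by
    intro p q hpq
    rw [← QuotientGroup.out_eq' p, ← QuotientGroup.out_eq' q]
    exact QuotientGroup.eq.2 (hf _ _ hpq)
  have := Finite.of_injective _ hinj
  exact ⟨Subgroup.finiteIndex_of_finite_quotient, Nat.card_le_card_of_injective _ hinj⟩

theorem card_le_of_commutative {K : Type*} [hK : Group K] (hcomm : ∀ x y : K, x * y = y * x)
    {s : Set K} (hs : s.Finite)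
    (hgen : Subgroup.closure s = ⊤) {d : ℕ} (hd : 0 < d) (hpow : ∀ x ∈ s, x ^ d = 1) :
    Finite K ∧ Nat.card K ≤ d ^ s.ncard := by
  let _ : CommGroup K := { hK with mul_comm := hcomm }
  have hall : ∀ x : K, x ^ d = 1 := fun x => by
    have : Subgroup.closure s ≤ (powMonoidHom d : K →* K).ker :=
      (Subgroup.closure_le _).2 hpow
    exact this (hgen ▸ Subgroup.mem_top x)
  have hfg : Group.FG K := ⟨⟨hs.toFinset, by simpa using hgen⟩⟩
  have hdvd := card_dvd_exponent_pow_rank' K hall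
  have hrank : Group.rank K ≤ s.ncard := by
    rw [Set.ncard_eq_toFinset_card s hs]
    exact Group.rank_le (by simpa using hgen)
  refine ⟨Nat.finite_of_card_ne_zero fun h => ?_, ?_⟩
  · rw [h, zero_dvd_iff] at hdvd
    exact (pow_pos hd _).ne' hdvd
  · exact (Nat.le_of_dvd (pow_pos hd _) hdvd).trans (Nat.pow_le_pow_right hd hrank)

theorem card_closure_le {K : Type*} [Group K] {s : Set K} (hs : s.Finite)
    (hcomm : ∀ x ∈ s, ∀ y ∈ s, x * y = y * x) {d : ℕ} (hd : 0 < d) (hpow : ∀ x ∈ s, x ^ d = 1) :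
    Finite (Subgroup.closure s) ∧ Nat.card (Subgroup.closure s) ≤ d ^ s.ncard := by
  have hc := Subgroup.isMulCommutative_closure hcomm
  have hmem : s ⊆ Set.range (Subtype.val : Subgroup.closure s → K) := fun x hx =>
    ⟨⟨x, Subgroup.subset_closure hx⟩, rfl⟩
  rw [← Set.ncard_preimage_of_injective_subset_range Subtype.val_injective hmem]
  refine card_le_of_commutative (fun x y => hc.is_comm.comm x y)
    (hs.preimage Subtype.val_injective.injOn) Subgroup.closure_closure_coe_preimage hd
    fun x hx => ?_
  exact Subtype.ext (hpow x.1 hx)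

/-! ### Commutator depth over a subgroup -/

section Depth

variable {G : Type u} [Group G] {B : Type v} [Group B]

/-- All commutators `[g, b₁, …, bₙ]` with entries in `B` lie in `S`. -/
def Depth (φ : B →* MulAut G) (S : Set G) : ℕ → G → Prop
  | 0, g => g ∈ S
  | n + 1, g => ∀ b, Depth φ S n (g⁻¹ * φ b g)

variable {φ : B →* MulAut G} {L : Subgroup G}

theorem Depth.succ (hL : IsInvariant φ L) {n : ℕ} :
    ∀ {g : G}, Depth φ L n g → Depth φ L (n + 1) g := by
  induction n with
  | zero => exact fun {g} hg b => mul_mem (inv_mem hg) (hL b g hg)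
  | succ n ih => exact fun {g} hg b => ih (hg b)

/-- The elements of `F` of depth at most `i` form an ascending chain. Since every element of `F`
reaches `L`, the chain can only stall at `F`, so it needs at most `|F|` strict steps. -/
theorem depth_ncard (hL : IsInvariant φ L) {F : Set G} (hF : F.Finite)
    (hclosed : ∀ y ∈ F, ∀ b, y⁻¹ * φ b y ∈ F) (hreach : ∀ y ∈ F, Reaches φ L y) :
    ∀ y ∈ F, Depth φ L F.ncard y := by
  set D : ℕ → Set G := fun i => {y | y ∈ F ∧ Depth φ L i y} with hD
  have hsub : ∀ i, D i ⊆ F := fun i y hy => hy.1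
  have hmono : ∀ i, D i ⊆ D (i + 1) := fun i y hy => ⟨hy.1, hy.2.succ hL⟩
  have hzero : ∀ i, ∀ y ∈ F, y ∈ L → Depth φ L i y := by
    intro i
    induction i with
    | zero => exact fun y _ hy => hy
    | succ i ih => exact fun y hyF hy => (ih y hyF hy).succ hL
  have hstat : ∀ i, D (i + 1) ⊆ D i → D i = F := by
    intro i hi
    refine (hsub i).antisymm fun y hy => ?_
    have hr := hreach y hy
    induction hr with
    | base h => exact ⟨hy, hzero i _ hy h⟩
    | step _ ih => exact hi ⟨hy, fun b => (ih b (hclosed _ hy b)).2⟩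
  have key : ∀ i, D i = F ∨ i ≤ (D i).ncard := by
    intro i
    induction i with
    | zero => exact .inr (Nat.zero_le _)
    | succ i ih =>
      by_cases h : D (i + 1) ⊆ D i
      · have := hstat i h
        exact .inl ((hsub _).antisymm (this ▸ hmono i))
      · rcases ih with ih | ih
        · exact absurd ((hsub _).trans ih.ge) h
        · exact .inr (ih.trans_lt (Set.ncard_lt_ncard ⟨hmono i, h⟩ (hF.subset (hsub _))))
  intro y hy
  have : D F.ncard = F := (key F.ncard).elim id fun h =>
    Set.eq_of_subset_of_ncard_le (hsub _) h hF
  exact (this.ge hy).2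

end Depth

/-! ### Triviality of the action on the centralizer of `L` -/

section Bound

variable {G : Type u} [Group G] {A : Type v} [Group A] {φ : A →* MulAut G} {L : Subgroup G}

theorem commutator_mem_centralizer (hL : IsInvariant φ L) {g : G}
    (hg : g ∈ Subgroup.centralizer (L : Set G)) (a : A) :
    g⁻¹ * φ a g ∈ Subgroup.centralizer (L : Set G) := by
  refine mul_mem (inv_mem hg) (Subgroup.mem_centralizer_iff.2 fun l hl => ?_)
  have h := Subgroup.mem_centralizer_iff.1 hg _ (hL a⁻¹ l hl)
  have h2 := congrArg (φ a) h
  simpa using h2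

variable {E : Subgroup A} [hEn : E.Normal]

/-- The point is that `[g, e]` is fixed by all of `A`. Conjugation by `n = [g, a]` comes from an
element of `E`, since `n` centralizes `L`; so `n` commutes with `[g, e]` by `ih`, and this cancels
the error term in `a [g, e]`. -/
theorem fixes_of_commutators_fix (hφ : NormalizedByInn φ)
    (hfix : ∀ x : G, (∀ a, φ a x = x) → x = 1) (hL : IsInvariant φ L)
    (hEc : ∀ b, ∀ n ∈ Subgroup.centralizer (L : Set G), φ b = MulAut.conj n → b ∈ E)
    {g : G} (hg : g ∈ Subgroup.centralizer (L : Set G))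
    (ih : ∀ a, ∀ e ∈ E, φ e (g⁻¹ * φ a g) = g⁻¹ * φ a g)
    {e : A} (he : e ∈ E) (h : ∀ a, φ (e⁻¹ * (a * e * a⁻¹)) g = g) : φ e g = g := by
  refine (inv_mul_eq_one.1 (hfix (g⁻¹ * φ e g) fun a => ?_)).symm
  set n := g⁻¹ * φ a g with hn
  obtain ⟨b, hb⟩ := hφ.exists_eq_conj_commutator g a
  have hbE : b ∈ E := hEc b n (commutator_mem_centralizer hL hg a) hb
  have hcomm : n * (g⁻¹ * φ e g) * n⁻¹ = g⁻¹ * φ e g := by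
    have := ih e b hbE
    rwa [hb, MulAut.conj_apply] at this
  have hag : φ a g = g * n := by rw [hn]; group
  have h1 : φ (a * e * a⁻¹) g = φ e g := by
    have h2 := congrArg (φ e) (h a)
    rw [← MulAut.mul_apply, ← map_mul] at h2
    simpa [mul_assoc] using h2
  have h3 : φ a (φ e g) = φ e g * n := by
    have h4 : φ a (φ e g) = φ (a * e * a⁻¹) (φ a g) := by simp [MulAut.mul_apply]
    rw [h4, hag, map_mul, h1, ih a _ (hEn.conj_mem e he a)]
  rw [map_mul, map_inv, h3, hag]
  calc (g * n)⁻¹ * (φ e g * n) = n⁻¹ * (g⁻¹ * φ e g) * n := by group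
    _ = n⁻¹ * (n * (g⁻¹ * φ e g) * n⁻¹) * n := by rw [hcomm]
    _ = g⁻¹ * φ e g := by group

/-- Three nested inductions: on `g` reaching `L`, on `n` reaching `L` when `e` is conjugation by
`n`, and on `e` reaching the inner automorphisms. The commutator of conjugation by `n` with `a` is
conjugation by `[n, a]`. -/
theorem fixes_centralizer (hφ : NormalizedByInn φ)
    (hfix : ∀ x : G, (∀ a, φ a x = x) → x = 1) (hL : IsInvariant φ L)
    (hreach : ∀ g, Reaches φ L g)
    (hEL : ∀ e ∈ E, ∀ l ∈ L, φ e l = l)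
    (hEc : ∀ b, ∀ n ∈ Subgroup.centralizer (L : Set G), φ b = MulAut.conj n → b ∈ E)
    (hEr : ∀ e ∈ E, Reaches (MulAut.conj : A →* MulAut A) {a | φ a ∈ inn G} e)
    {g : G} (hg : g ∈ Subgroup.centralizer (L : Set G)) : ∀ e ∈ E, φ e g = g := by
  have hr := hreach g
  induction hr with
  | base h => exact fun e he => hEL e he _ h
  | @step g _ ih =>
    replace ih := fun a => ih a (commutator_mem_centralizer hL hg a)
    have hcE : ∀ e ∈ E, ∀ a, e⁻¹ * (a * e * a⁻¹) ∈ E := fun e he a =>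
      mul_mem (inv_mem he) (hEn.conj_mem e he a)
    have hinner : ∀ n, ∀ e ∈ E, φ e = MulAut.conj n → φ e g = g := by
      intro n
      have hr := hreach n
      induction hr with
      | @base n h =>
        intro e he hen
        rw [hen, MulAut.conj_apply, Subgroup.mem_centralizer_iff.1 hg n h, mul_inv_cancel_right]
      | @step n _ ihn =>
        intro e he hen
        refine fixes_of_commutators_fix hφ hfix hL hEc hg ih he fun a =>
          ihn a _ (hcE e he a) ?_
        ext x
        simp [hen, MulAut.mul_apply, mul_assoc]
    intro e he
    have hr := hEr e he
    induction hr with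
    | base h =>
      obtain ⟨n, hn⟩ := h
      exact hinner n _ he hn.symm
    | @step e _ ihe =>
      exact fixes_of_commutators_fix hφ hfix hL hEc hg ih he fun a => ihe a (hcE e he a)

end Bound

/-! ### Bounding the index of the hypercenter -/

section Bound

variable {G : Type u} [Group G] {A : Type v} [Group A] {φ : A →* MulAut G} {L : Subgroup G}

theorem Depth.mono (hL : IsInvariant φ L) {m n : ℕ} (hmn : m ≤ n) {g : G}
    (h : Depth φ L m g) : Depth φ L n g := by
  induction hmn with
  | refl => exact h
  | step _ ih => exact ih.succ hL

/-- An element whose commutators with `A` coincide with those of another one differs from it by a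
fixed point. -/
theorem eq_of_commutators_eq (hfix : ∀ x : G, (∀ a, φ a x = x) → x = 1) {g g' : G}
    (h : ∀ a, g⁻¹ * φ a g = g'⁻¹ * φ a g') : g = g' := by
  refine (mul_inv_eq_one.1 (hfix (g' * g⁻¹) fun a => ?_)).symm
  have h1 : φ a g' = g' * (g⁻¹ * φ a g) := by rw [h a]; group
  rw [map_mul, map_inv, h1]
  group

variable {E : Subgroup A}

/-- An element of `C` is determined by the function `q ↦ [g, q]` on `A/E`, whose values have depth
one less. Each level thus raises the bound to the power `|A/E|`. -/
theorem card_depth_le (hfix : ∀ x : G, (∀ a, φ a x = x) → x = 1) [Finite L] [E.FiniteIndex]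
    {C : Subgroup G} (hC : ∀ g ∈ C, ∀ a, g⁻¹ * φ a g ∈ C) (hE : ∀ g ∈ C, ∀ e ∈ E, φ e g = g)
    (i : ℕ) :
    {g | g ∈ C ∧ Depth φ L i g}.Finite ∧
      {g | g ∈ C ∧ Depth φ L i g}.ncard ≤ Nat.card L ^ E.index ^ i := by
  induction i with
  | zero =>
    have hsub : {g | g ∈ C ∧ Depth φ (L : Set G) 0 g} ⊆ (L : Set G) := fun g hg => hg.2
    have hfin : (L : Set G).Finite := Set.toFinite _
    refine ⟨hfin.subset hsub, (Set.ncard_le_ncard hsub hfin).trans ?_⟩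
    rw [pow_zero, pow_one]
    exact (Nat.card_coe_set_eq (L : Set G)).ge
  | succ i ih =>
    obtain ⟨hfin, hcard⟩ := ih
    have := hfin.to_subtype
    let f : {g | g ∈ C ∧ Depth φ (L : Set G) (i + 1) g} →
        (A ⧸ E → {g | g ∈ C ∧ Depth φ (L : Set G) i g}) := fun g q =>
      ⟨g.1⁻¹ * φ q.out g.1, hC _ g.2.1 _, g.2.2 _⟩
    have hf : Function.Injective f := by
      intro g g' hgg
      refine Subtype.ext (eq_of_commutators_eq hfix fun a => ?_)
      have h1 : ∀ x ∈ C, φ a x = φ (a : A ⧸ E).out x := fun x hx => by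
        have h2 : (a : A ⧸ E).out⁻¹ * a ∈ E :=
          QuotientGroup.eq.1 (QuotientGroup.out_eq' (a : A ⧸ E))
        have h3 := congrArg (φ (a : A ⧸ E).out) (hE x hx _ h2)
        rw [← MulAut.mul_apply, ← map_mul] at h3
        simpa using h3
      rw [h1 _ g.2.1, h1 _ g'.2.1]
      exact congrArg Subtype.val (congrFun hgg a)
    refine ⟨Set.finite_coe_iff.1 (Finite.of_injective f hf), ?_⟩
    have h1 := Nat.card_le_card_of_injective f hf
    rw [Nat.card_fun, Nat.card_coe_set_eq, Nat.card_coe_set_eq, ← Subgroup.index] at h1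
    rw [pow_succ, pow_mul]
    exact h1.trans (Nat.pow_le_pow_left hcard _)

theorem card_le_of_no_fixed_points (hφ : NormalizedByInn φ)
    (hfix : ∀ x : G, (∀ a, φ a x = x) → x = 1) [L.Normal] (hL : IsInvariant φ L) [Finite L]
    (hreach : ∀ g, Reaches φ L g) [E.Normal] [E.FiniteIndex]
    (hEL : ∀ e ∈ E, ∀ l ∈ L, φ e l = l)
    (hEc : ∀ b, ∀ n ∈ Subgroup.centralizer (L : Set G), φ b = MulAut.conj n → b ∈ E)
    (hEr : ∀ e ∈ E, Reaches (MulAut.conj : A →* MulAut A) {a | φ a ∈ inn G} e) :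
    Finite G ∧ Nat.card G ≤
      Nat.card L ^ E.index ^ (Nat.card L ^ E.index + 1) * Nat.card L ^ Nat.card L := by
  set d := Nat.card L with hd
  set n := E.index with hn
  have hdpos : 0 < d := Nat.card_pos
  set C := Subgroup.centralizer (L : Set G) with hCdef
  have hC : ∀ g ∈ C, ∀ a, g⁻¹ * φ a g ∈ C := fun g hg a => commutator_mem_centralizer hL hg a
  have hCinv : ∀ g ∈ C, ∀ a, φ a g ∈ C := fun g hg a => by
    simpa using mul_mem hg (hC g hg a)
  have hE : ∀ g ∈ C, ∀ e ∈ E, φ e g = g := fun g hg =>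
    fixes_centralizer hφ hfix hL hreach hEL hEc hEr hg
  -- An element of `C` whose conjugation comes from `A` is central in `C`, because that `b` lies in
  -- `E`. All `[g, a]` with `g ∈ C` are of this kind, so `g ↦ [g, a]` is a homomorphism on `C`.
  have hcent : ∀ m ∈ C, ∀ b, φ b = MulAut.conj m → ∀ g ∈ C, m * g = g * m := by
    intro m hm b hb g hg
    have h := hE g hg b (hEc b m hm hb)
    rw [hb, MulAut.conj_apply] at h
    exact mul_inv_eq_iff_eq_mul.1 h
  have hhom : ∀ g ∈ C, ∀ g' ∈ C, ∀ a,
      (g * g')⁻¹ * φ a (g * g') = g⁻¹ * φ a g * (g'⁻¹ * φ a g') := by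
    intro g hg g' hg' a
    obtain ⟨b, hb⟩ := hφ.exists_eq_conj_commutator g a
    have h := hcent _ (hC g hg a) b hb g'⁻¹ (inv_mem hg')
    calc (g * g')⁻¹ * φ a (g * g') = g'⁻¹ * (g⁻¹ * φ a g) * φ a g' := by rw [map_mul]; group
      _ = g⁻¹ * φ a g * (g'⁻¹ * φ a g') := by rw [← h]; group
  have hhompow : ∀ g ∈ C, ∀ a (m : ℕ), (g ^ m)⁻¹ * φ a (g ^ m) = (g⁻¹ * φ a g) ^ m := by
    intro g hg a m
    induction m with
    | zero => simp
    | succ m ih => rw [pow_succ, hhom _ (pow_mem hg m) _ hg, ih, pow_succ]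
  -- Inductively `[g ^ d, a] = [g, a] ^ d = 1`, so `g ^ d` is a fixed point.
  have hpow : ∀ g ∈ C, g ^ d = 1 := by
    intro g hg
    have hr := hreach g
    induction hr with
    | @base g h => exact congrArg Subtype.val (pow_card_eq_one' (x := (⟨g, h⟩ : L)))
    | @step g _ ih =>
      refine hfix _ fun a => (inv_mul_eq_one.1 ?_).symm
      rw [hhompow g hg, ih a (hC g hg a)]
  -- The `A`-orbit of `y` has at most `n` elements, which commute and have exponent `d`. They
  -- generate an invariant group of order at most `d ^ n`.
  have hdepth : ∀ y ∈ C, ∀ b, φ b = MulAut.conj y → Depth φ L (d ^ n) y := by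
    intro y hy b hb
    set s : Set G := Set.range fun a => φ a y with hs
    have hs' : s ⊆ Set.range fun q : A ⧸ E => φ q.out y := by
      rintro _ ⟨a, rfl⟩
      refine ⟨a, ?_⟩
      have h2 : (a : A ⧸ E).out⁻¹ * a ∈ E :=
        QuotientGroup.eq.1 (QuotientGroup.out_eq' (a : A ⧸ E))
      have h3 := congrArg (φ (a : A ⧸ E).out) (hE y hy _ h2)
      rw [← MulAut.mul_apply, ← map_mul] at h3
      simpa using h3.symm
    have hsfin : s.Finite := (Set.finite_range _).subset hs'
    have hscard : s.ncard ≤ n := by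
      refine (Set.ncard_le_ncard hs' (Set.finite_range _)).trans ?_
      rw [← Nat.card_coe_set_eq]
      exact Finite.card_range_le _
    have hscomm : ∀ x ∈ s, ∀ x' ∈ s, x * x' = x' * x := by
      rintro _ ⟨a, rfl⟩ _ ⟨a', rfl⟩
      refine hcent _ (hCinv y hy a) (a * b * a⁻¹) ?_ _ (hCinv y hy a')
      ext x
      simp [hb, MulAut.mul_apply]
    obtain ⟨hfin, hcard⟩ := card_closure_le hsfin hscomm hdpos (by
      rintro _ ⟨a, rfl⟩
      exact hpow _ (hCinv y hy a))
    have hinv : IsInvariant φ (Subgroup.closure s) := by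
      intro a
      change Subgroup.closure s ≤ (Subgroup.closure s).comap ((φ a : G ≃* G) : G →* G)
      rw [Subgroup.closure_le]
      rintro _ ⟨a', rfl⟩
      refine Subgroup.subset_closure ⟨a * a', ?_⟩
      simp [MulAut.mul_apply]
    have h := depth_ncard hL (F := (Subgroup.closure s : Set G)) (Set.toFinite _)
      (fun y hy b => mul_mem (inv_mem hy) (hinv b y hy)) (fun y _ => hreach y) y
      (Subgroup.subset_closure ⟨1, by simp⟩)
    refine h.mono hL ?_
    rw [← Nat.card_coe_set_eq]
    exact hcard.trans (Nat.pow_le_pow_right hdpos hscard)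
  -- The depth bound holds for the commutators of `g`; one more level covers `g` itself.
  have hall : {g | g ∈ C ∧ Depth φ (L : Set G) (d ^ n + 1) g} = (C : Set G) := by
    ext g
    refine ⟨fun h => h.1, fun hg => ⟨hg, fun a => ?_⟩⟩
    obtain ⟨b, hb⟩ := hφ.exists_eq_conj_commutator g a
    exact hdepth _ (hC g hg a) b hb
  obtain ⟨hCfin, hCcard⟩ := card_depth_le (L := L) hfix hC hE (d ^ n + 1)
  rw [hall] at hCfin hCcard
  -- The index of `C` is bounded by the number of self-maps of `L`, through conjugation.
  obtain ⟨hidx, hidx'⟩ := index_le_card_of_map C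
    (fun (g : G) (l : L) => (⟨g * l * g⁻¹, Subgroup.Normal.conj_mem ‹_› _ l.2 g⟩ : L)) (by
      intro a b hab
      refine Subgroup.mem_centralizer_iff.2 fun l hl => ?_
      have h := congrArg Subtype.val (congrFun hab ⟨l, hl⟩)
      change a * l * a⁻¹ = b * l * b⁻¹ at h
      calc l * (a⁻¹ * b) = a⁻¹ * (a * l * a⁻¹) * b := by group
        _ = a⁻¹ * b * l := by rw [h]; group)
  have hCfin' : Finite C := hCfin.to_subtype
  have hcardG := Subgroup.card_mul_index C
  rw [Nat.card_fun] at hidx'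
  refine ⟨Nat.finite_of_card_ne_zero ?_, ?_⟩
  · rw [← hcardG]
    exact mul_ne_zero Nat.card_pos.ne' hidx.index_ne_zero
  · rw [← hcardG]
    refine Nat.mul_le_mul ?_ hidx'
    rw [← Nat.card_coe_set_eq] at hCcard
    exact hCcard

/-- The elements of `A` acting trivially on `L`. -/
def pointwiseFixer (φ : A →* MulAut G) (L : Subgroup G) : Subgroup A where
  carrier := {a | ∀ l ∈ L, φ a l = l}
  mul_mem' ha hb l hl := by rw [map_mul, MulAut.mul_apply, hb l hl, ha l hl]
  one_mem' l _ := by simp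
  inv_mem' {a} ha l hl := by
    rw [map_inv, MulAut.inv_apply, MulEquiv.symm_apply_eq]
    exact (ha l hl).symm

theorem pointwiseFixer_normal (hL : IsInvariant φ L) : (pointwiseFixer φ L).Normal where
  conj_mem e he a l hl := by
    rw [map_mul, map_mul, MulAut.mul_apply, MulAut.mul_apply, he _ (hL a⁻¹ l hl)]
    simp

theorem pointwiseFixer_index_le (hL : IsInvariant φ L) [Finite L] :
    (pointwiseFixer φ L).FiniteIndex ∧
      (pointwiseFixer φ L).index ≤ Nat.card L ^ Nat.card L := by
  have h := index_le_card_of_map (pointwiseFixer φ L)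
    (fun a (l : L) => (⟨φ a l, hL a l l.2⟩ : L)) (by
      intro a b hab l hl
      have h := congrArg Subtype.val (congrFun hab ⟨l, hl⟩)
      change φ a l = φ b l at h
      rw [map_mul, MulAut.mul_apply, ← h]
      simp)
  rwa [Nat.card_fun] at h

theorem reaches_conj_quotient_iff (N : Subgroup A) [N.Normal] (a : A) :
    Reaches (MulAut.conj : A ⧸ N →* MulAut (A ⧸ N)) {1} (a : A ⧸ N) ↔
      Reaches (MulAut.conj : A →* MulAut A) N a := by
  constructor
  · intro h
    generalize hq : (a : A ⧸ N) = q at h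
    induction h generalizing a with
    | base h =>
      rw [Set.mem_singleton_iff.1 h, QuotientGroup.eq_one_iff] at hq
      exact .base hq
    | step _ ih =>
      subst hq
      exact .step fun b => ih b _ rfl
  · intro h
    induction h with
    | base h => exact .base ((QuotientGroup.eq_one_iff _).2 h)
    | step _ ih =>
      refine .step fun q => ?_
      induction q using QuotientGroup.induction_on with
      | H b => exact ih b

theorem mk_mem_hypercenter_iff (N : Subgroup A) [N.Normal] (a : A) :
    (a : A ⧸ N) ∈ hypercenter (A ⧸ N) ↔ Reaches (MulAut.conj : A →* MulAut A) N a :=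
  (mem_actionHypercenter_iff _ _).trans (reaches_conj_quotient_iff N a)

/-- A bound for the index of the hypercenter, in terms of the order of a finite normal subgroup
with hypercentral quotient and the index of the hypercenter of the outer action. -/
def indexBound (d k : ℕ) : ℕ :=
  d ^ (k * d ^ d) ^ (d ^ (k * d ^ d) + 1) * d ^ d

theorem indexBound_aux {d n d' n' : ℕ} (hd : 0 < d) (hn : 0 < n) (hdd : d ≤ d') (hnn : n ≤ n') :
    d ^ n ^ (d ^ n + 1) * d ^ d ≤ d' ^ n' ^ (d' ^ n' + 1) * d' ^ d' := by
  have hd' : 0 < d' := hd.trans_le hdd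
  have hn' : 0 < n' := hn.trans_le hnn
  have h1 : d ^ n ≤ d' ^ n' :=
    (Nat.pow_le_pow_left hdd n).trans (Nat.pow_le_pow_right hd' hnn)
  have h2 : n ^ (d ^ n + 1) ≤ n' ^ (d' ^ n' + 1) :=
    (Nat.pow_le_pow_left hnn _).trans (Nat.pow_le_pow_right hn' (Nat.succ_le_succ h1))
  exact Nat.mul_le_mul
    ((Nat.pow_le_pow_left hdd _).trans (Nat.pow_le_pow_right hd' h2))
    ((Nat.pow_le_pow_left hdd _).trans (Nat.pow_le_pow_right hd' hdd))

theorem card_le_indexBound (hφ : NormalizedByInn φ)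
    (hfix : ∀ x : G, (∀ a, φ a x = x) → x = 1) [L.Normal] (hL : IsInvariant φ L) [Finite L]
    (hreach : ∀ g, Reaches φ L g) (H : Subgroup A) [H.FiniteIndex]
    (hH : ∀ h ∈ H, Reaches (MulAut.conj : A →* MulAut A) {a | φ a ∈ inn G} h)
    {d k : ℕ} (hd : Nat.card L ≤ d) (hk : H.index ≤ k) :
    Finite G ∧ Nat.card G ≤ indexBound d k := by
  let D : Subgroup A := (inn G).comap φ
  -- `H` need not be normal; the full preimage of the hypercenter is, and contains `H`.
  let H' : Subgroup A := (hypercenter (A ⧸ D)).comap (QuotientGroup.mk' D)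
  have hH' : ∀ a, a ∈ H' ↔ Reaches (MulAut.conj : A →* MulAut A) {a | φ a ∈ inn G} a :=
    mk_mem_hypercenter_iff D
  have hle : H ≤ H' := fun h hh => (hH' h).2 (hH h hh)
  have hfi : H'.FiniteIndex := Subgroup.finiteIndex_of_le hle
  have : (hypercenter (A ⧸ D)).Normal := actionHypercenter_normal _ _
  have := pointwiseFixer_normal hL
  obtain ⟨hfi', hidx⟩ := pointwiseFixer_index_le hL
  have hEn : (H' ⊓ pointwiseFixer φ L).Normal := inferInstance
  obtain ⟨hfin, hcard⟩ := card_le_of_no_fixed_points (E := H' ⊓ pointwiseFixer φ L) hφ hfix hL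
    hreach (fun e he => he.2)
    (fun b n hn hb => ⟨(hH' b).2 (.base ⟨n, hb.symm⟩), fun l hl => by
      rw [hb, MulAut.conj_apply, ← Subgroup.mem_centralizer_iff.1 hn l hl, mul_inv_cancel_right]⟩)
    (fun e he => (hH' e).1 he.1)
  refine ⟨hfin, hcard.trans (indexBound_aux Nat.card_pos
    (Nat.pos_of_ne_zero Subgroup.FiniteIndex.index_ne_zero) hd ?_)⟩
  refine Subgroup.index_inf_le.trans (Nat.mul_le_mul ?_ (hidx.trans ?_))
  · exact (Nat.le_of_dvd (Nat.pos_of_ne_zero Subgroup.FiniteIndex.index_ne_zero)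
      (Subgroup.index_dvd_of_le hle)).trans hk
  · exact (Nat.pow_le_pow_left hd _).trans
      (Nat.pow_le_pow_right (Nat.card_pos.trans_le hd) hd)

/-- If the hypercenter has finite index in a normal invariant subgroup `L` with hypercentral
quotient, then it has finite index, with a bound depending only on these data. -/
theorem index_actionHypercenter_le (hφ : NormalizedByInn φ) [L.Normal] (hL : IsInvariant φ L)
    (hreach : ∀ g, Reaches φ L g) (H : Subgroup A) [H.FiniteIndex]
    (hH : ∀ h ∈ H, Reaches (MulAut.conj : A →* MulAut A) {a | φ a ∈ inn G} h)
    {d k : ℕ} (hd : (actionHypercenter φ hφ).relIndex L ≤ d)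
    (hd0 : (actionHypercenter φ hφ).relIndex L ≠ 0) (hk : H.index ≤ k) :
    (actionHypercenter φ hφ).FiniteIndex ∧ (actionHypercenter φ hφ).index ≤ indexBound d k := by
  set Z := actionHypercenter φ hφ with hZ
  have hZn : Z.Normal := actionHypercenter_normal φ hφ
  have hZi : IsInvariant φ Z := actionHypercenter_invariant φ hφ
  have hcard : Nat.card (L.map (QuotientGroup.mk' Z)) = Z.relIndex L := by
    rw [← Subgroup.relIndex_ker, QuotientGroup.ker_mk']
  have hLn : (L.map (QuotientGroup.mk' Z)).Normal :=
    Subgroup.Normal.map ‹_› _ (QuotientGroup.mk'_surjective Z)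
  have hLf : Finite (L.map (QuotientGroup.mk' Z)) :=
    Nat.finite_of_card_ne_zero (hcard ▸ hd0)
  have hLi : IsInvariant (quotientAction φ Z hZi) (L.map (QuotientGroup.mk' Z)) := by
    rintro b _ ⟨l, hl, rfl⟩
    exact ⟨φ b l, hL b l hl, rfl⟩
  have hr : ∀ q, Reaches (quotientAction φ Z hZi)
      (L.map (QuotientGroup.mk' Z) : Set (G ⧸ Z)) q := by
    intro q
    induction q using QuotientGroup.induction_on with
    | H g =>
      have h := hreach g
      induction h with
      | base h => exact .base ⟨_, h, rfl⟩
      | step _ ih => exact .step ih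
  have hfix : ∀ x : G ⧸ Z, (∀ a, quotientAction φ Z hZi a x = x) → x = 1 := by
    intro x hx
    induction x using QuotientGroup.induction_on with
    | H g =>
      rw [QuotientGroup.eq_one_iff]
      exact mem_actionHypercenter_of_forall φ hφ fun b => QuotientGroup.eq.1 (hx b).symm
  obtain ⟨hfin, hle⟩ := card_le_indexBound (hφ.quotientAction Z hZi) hfix hLi hr H
    (fun h hh => (hH h hh).trans fun a ha => .base (by
      obtain ⟨g, hg⟩ := ha
      refine ⟨(g : G ⧸ Z), ?_⟩
      ext x
      induction x using QuotientGroup.induction_on with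
      | H x => rw [quotientAction_mk, ← hg]; rfl)) (hcard ▸ hd) hk
  exact ⟨Subgroup.finiteIndex_of_finite_quotient, hle⟩

end Bound

/-! ### Systems of commutator equations -/

section Words

variable {G : Type u} [Group G] {ι : Type v}

/-- The product of the commutators `[x j, a]`, for `(j, a)` running over a list. -/
def commWord (w : List (ι × MulAut G)) (x : ι → G) : G :=
  (w.map fun p => (x p.1)⁻¹ * p.2 (x p.1)).prod

theorem commWord_cons (p : ι × MulAut G) (w : List (ι × MulAut G)) (x : ι → G) :
    commWord (p :: w) x = (x p.1)⁻¹ * p.2 (x p.1) * commWord w x := by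
  simp [commWord]

/-- The word obtained from `w` by conjugating all automorphisms by `σ`. -/
def conjWord (σ : MulAut G) (w : List (ι × MulAut G)) : List (ι × MulAut G) :=
  w.map fun p => (p.1, σ * p.2 * σ⁻¹)

theorem commWord_conjWord (σ : MulAut G) (w : List (ι × MulAut G)) (x : ι → G) :
    commWord (conjWord σ w) (fun i => σ (x i)) = σ (commWord w x) := by
  induction w with
  | nil => simp [conjWord, commWord]
  | cons p w ih =>
    change commWord ((p.1, σ * p.2 * σ⁻¹) :: conjWord σ w) _ = _
    rw [commWord_cons, commWord_cons, ih]
    simp [MulAut.mul_apply]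

theorem commWord_conjWord_of_fixes {σ : MulAut G} {w : List (ι × MulAut G)} {x : ι → G}
    (h : ∀ p ∈ w, ∀ j, (p.2⁻¹ * (σ * p.2 * σ⁻¹)) (x j) = x j) :
    commWord (conjWord σ w) x = commWord w x := by
  induction w with
  | nil => rfl
  | cons p w ih =>
    change commWord ((p.1, σ * p.2 * σ⁻¹) :: conjWord σ w) _ = _
    rw [commWord_cons, commWord_cons, ih fun q hq => h q (List.mem_cons_of_mem _ hq)]
    have h1 := congrArg p.2 (h p List.mem_cons_self p.1)
    rw [MulAut.mul_apply, MulAut.apply_inv_self] at h1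
    rw [h1]

variable {A : Subgroup (MulAut G)} (hA : NormalizedByInn A.subtype)

theorem mk_commWord_congr {x x' : ι → G} {N : Subgroup G} [N.Normal] {w : List (ι × MulAut G)}
    (h : ∀ p ∈ w, (((x p.1)⁻¹ * p.2 (x p.1) : G) : G ⧸ N) = ((x' p.1)⁻¹ * p.2 (x' p.1) : G)) :
    ((commWord w x : G) : G ⧸ N) = (commWord w x' : G) := by
  induction w with
  | nil => rfl
  | cons p w ih =>
    rw [commWord_cons, commWord_cons]
    exact congrArg₂ (· * ·) (h p List.mem_cons_self)
      (ih fun q hq => h q (List.mem_cons_of_mem _ hq))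

/-- Words of commutators contract along an `A`-central section. -/
theorem mk_commWord_eq_of_central (hA : NormalizedByInn A.subtype) {M N : Subgroup G}
    [hN : N.Normal]
    (hMN : ∀ y ∈ M, ∀ a ∈ A, y⁻¹ * a y ∈ N) {w : List (ι × MulAut G)} (hw : ∀ p ∈ w, p.2 ∈ A)
    {x x' : ι → G} (hx : ∀ i, (x i)⁻¹ * x' i ∈ M) :
    ((commWord w x : G) : G ⧸ N) = (commWord w x' : G) := by
  refine mk_commWord_congr fun p hp => QuotientGroup.eq.2 ?_
  set n := (x p.1)⁻¹ * p.2 (x p.1) with hn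
  set y := (x p.1)⁻¹ * x' p.1 with hy
  -- Conjugation by `n` belongs to `A`, so it acts trivially on `M` modulo `N`; hence `[x y, a] ≡
  -- [x, a]`.
  obtain ⟨b, hb⟩ := hA.exists_eq_conj_commutator (x p.1) ⟨p.2, hw p hp⟩
  have h1 := hMN y (hx p.1) b.1 b.2
  rw [show (b : MulAut G) = MulAut.conj n from hb, MulAut.conj_apply] at h1
  have h2 := mul_mem (hN.conj_mem _ h1 n⁻¹) (hMN y (hx p.1) p.2 (hw p hp))
  have hx' : x' p.1 = x p.1 * y := by rw [hy]; group
  have h3 : n⁻¹ * ((x' p.1)⁻¹ * p.2 (x' p.1)) =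
      n⁻¹ * (y⁻¹ * (n * y * n⁻¹)) * n⁻¹⁻¹ * (y⁻¹ * p.2 y) := by
    rw [hx', map_mul, hn]; group
  rw [h3]
  exact h2

theorem commWord_inv_mul_mem_of_succ (β : Ordinal.{u}) {w : List (ι × MulAut G)}
    (hw : ∀ p ∈ w, p.2 ∈ A) {x x' : ι → G}
    (hx : ∀ i, (x i)⁻¹ * x' i ∈ (centerSeries A.subtype hA (β + 1)).toSubgroup) :
    (commWord w x)⁻¹ * commWord w x' ∈ (centerSeries A.subtype hA β).toSubgroup := by
  have := (centerSeries A.subtype hA β).normal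
  exact QuotientGroup.eq.1 (mk_commWord_eq_of_central hA
    (fun y hy a ha => (mem_centerSeries_succ A.subtype hA β y).1 hy ⟨a, ha⟩) hw hx)

variable [Finite ι]

/-- Finiteness of `ι` is what lets a whole tuple descend below a limit ordinal. -/
theorem exists_lt_forall_mem_centerSeries {l : Ordinal.{u}} (hl : Order.IsSuccLimit l)
    {y : ι → G} (hy : ∀ i, y i ∈ (centerSeries A.subtype hA l).toSubgroup) :
    ∃ β < l, ∀ i, y i ∈ (centerSeries A.subtype hA β).toSubgroup := by
  choose β hβl hβ using fun i => (mem_centerSeries_limit A.subtype hA hl (y i)).1 (hy i)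
  have : Nonempty (Set.Iio l) := ⟨⟨0, hl.bot_lt⟩⟩
  obtain ⟨M, hM⟩ := Finite.exists_le fun i => (⟨β i, hβl i⟩ : Set.Iio l)
  exact ⟨M.1, M.2, fun i => centerSeries_mono A.subtype hA (hM i) (hβ i)⟩

/-- Iterate `x ↦ w(x)`: an error in `Z_{β+1}` becomes an error in `Z_β`. Well-foundedness of the
ordinals makes the iteration stop. -/
theorem exists_commWord_fixed {w : ι → List (ι × MulAut G)} (hw : ∀ i, ∀ p ∈ w i, p.2 ∈ A)
    {x : ι → G} (hx : ∀ i, (x i)⁻¹ * commWord (w i) x ∈ actionHypercenter A.subtype hA) :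
    ∃ l : ι → G, (∀ i, commWord (w i) l = l i) ∧
      ∀ i, (x i)⁻¹ * l i ∈ actionHypercenter A.subtype hA := by
  obtain ⟨α, hα⟩ := exists_centerSeries_eq A.subtype hA
  rw [← hα] at hx
  have hle : ∀ β, (centerSeries A.subtype hA β).toSubgroup ≤ actionHypercenter A.subtype hA :=
    le_iSup fun α : Ordinal.{u} => (centerSeries A.subtype hA α).toSubgroup
  clear hα
  induction α using Ordinal.limitRecOn generalizing x with
  | zero =>
    refine ⟨x, fun i => ?_, fun i => by simp [one_mem]⟩
    have h := hx i
    rw [centerSeries_zero, Subgroup.mem_bot, inv_mul_eq_one] at h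
    exact h.symm
  | add_one β ih =>
    obtain ⟨l, hl, hl'⟩ := ih (x := fun i => commWord (w i) x) fun i =>
      commWord_inv_mul_mem_of_succ hA β (hw i) hx
    refine ⟨l, hl, fun i => ?_⟩
    have := mul_mem (hle _ (hx i)) (hl' i)
    simpa using this
  | limit l hl ih =>
    obtain ⟨β, hβ, h⟩ := exists_lt_forall_mem_centerSeries hA hl hx
    exact ih β hβ h

theorem commWord_fixed_unique {w : ι → List (ι × MulAut G)} (hw : ∀ i, ∀ p ∈ w i, p.2 ∈ A)
    {l l' : ι → G} (hl : ∀ i, commWord (w i) l = l i) (hl' : ∀ i, commWord (w i) l' = l' i)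
    (h : ∀ i, (l i)⁻¹ * l' i ∈ actionHypercenter A.subtype hA) : l = l' := by
  obtain ⟨α, hα⟩ := exists_centerSeries_eq A.subtype hA
  rw [← hα] at h
  clear hα
  induction α using Ordinal.limitRecOn with
  | zero =>
    funext i
    have h := h i
    rwa [centerSeries_zero, Subgroup.mem_bot, inv_mul_eq_one] at h
  | add_one β ih =>
    refine ih fun i => ?_
    rw [← hl i, ← hl' i]
    exact commWord_inv_mul_mem_of_succ hA β (hw i) h
  | limit l hl ih =>
    obtain ⟨β, hβ, h⟩ := exists_lt_forall_mem_centerSeries hA hl h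
    exact ih β hβ h

/-- `σ l` solves the system with automorphisms conjugated by `σ`. So does `l`, as `a` and `σ a σ⁻¹`
agree on its entries; uniqueness then gives `σ l = l`. -/
theorem fixes_of_conj_fixes {w : ι → List (ι × MulAut G)} (hw : ∀ i, ∀ p ∈ w i, p.2 ∈ A)
    {l : ι → G} (hl : ∀ i, commWord (w i) l = l i) {σ : MulAut G}
    (hσA : ∀ a ∈ A, σ * a * σ⁻¹ ∈ A)
    (hσZ : ∀ i, (l i)⁻¹ * σ (l i) ∈ actionHypercenter A.subtype hA)
    (hσ : ∀ a ∈ A, ∀ j, (a⁻¹ * (σ * a * σ⁻¹)) (l j) = l j) (i : ι) : σ (l i) = l i := by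
  have h := commWord_fixed_unique hA (w := fun i => conjWord σ (w i)) (l := l)
    (l' := fun i => σ (l i)) (fun i p hp => ?_) (fun i => ?_) (fun i => ?_) hσZ
  · exact (congrFun h i).symm
  · obtain ⟨q, hq, rfl⟩ := List.mem_map.1 hp
    exact hσA _ (hw i q hq)
  · rw [commWord_conjWord_of_fixes fun p hp => hσ p.2 (hw i p hp), hl]
  · rw [commWord_conjWord, hl]

theorem conj_mem_of_normalizedByInn (hA : NormalizedByInn A.subtype) (g : G) {a : MulAut G}
    (ha : a ∈ A) :
    MulAut.conj g * a * (MulAut.conj g)⁻¹ ∈ A := by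
  obtain ⟨c, hc⟩ := hA.exists_conj g ⟨a, ha⟩
  have : MulAut.conj g * a * (MulAut.conj g)⁻¹ = c := by
    ext x
    have h := hc x
    change (c : MulAut G) x = g * a (g⁻¹ * x * g) * g⁻¹ at h
    rw [h]
    simp [MulAut.mul_apply]
  rw [this]
  exact c.2

theorem hypercenter_centralizes_fixed {w : ι → List (ι × MulAut G)}
    (hw : ∀ i, ∀ p ∈ w i, p.2 ∈ A) {l : ι → G} (hl : ∀ i, commWord (w i) l = l i) {z : G}
    (hz : z ∈ actionHypercenter A.subtype hA) : ∀ i, MulAut.conj z (l i) = l i := by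
  have hn := actionHypercenter_normal A.subtype hA
  have hr := (mem_actionHypercenter_iff A.subtype hA).1 hz
  induction hr with
  | base h => simp [Set.mem_singleton_iff.1 h]
  | @step z _ ih =>
    have hzA : ∀ a ∈ A, z⁻¹ * a z ∈ actionHypercenter A.subtype hA := fun a ha =>
      mul_mem (inv_mem hz) (actionHypercenter_invariant A.subtype hA ⟨a, ha⟩ z hz)
    -- With `σ` conjugation by `z⁻¹`, the automorphism `a⁻¹ σ a σ⁻¹` is the inverse of conjugation
    -- by `[z, a⁻¹]`, to which the induction applies.
    have key := fixes_of_conj_fixes hA hw hl (σ := MulAut.conj z⁻¹)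
      (fun a ha => conj_mem_of_normalizedByInn hA _ ha) (fun i => ?_) (fun a ha j => ?_)
    · intro i
      have h := congrArg (MulAut.conj z) (key i)
      rw [map_inv, MulAut.apply_inv_self] at h
      exact h.symm
    · have h := mul_mem (hn.conj_mem _ (inv_mem hz) (l i)⁻¹) hz
      simpa [mul_assoc] using h
    · have h := ih ⟨a⁻¹, inv_mem ha⟩ (hzA _ (inv_mem ha)) j
      have h2 : a⁻¹ * (MulAut.conj z⁻¹ * a * (MulAut.conj z⁻¹)⁻¹) =
          (MulAut.conj (z⁻¹ * a⁻¹ z))⁻¹ := by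
        ext x
        simp [MulAut.mul_apply, mul_assoc]
      rw [h2, MulAut.inv_apply, MulEquiv.symm_apply_eq]
      exact h.symm

theorem reaches_one_fixes {w : ι → List (ι × MulAut G)}
    (hw : ∀ i, ∀ p ∈ w i, p.2 ∈ A) {l : ι → G} (hl : ∀ i, commWord (w i) l = l i)
    {X : Subgroup A} [hX : X.Normal]
    (hXZ : ∀ e ∈ X, ∀ g : G, g⁻¹ * e.1 g ∈ actionHypercenter A.subtype hA) {e : A}
    (he : e ∈ X) (hr : Reaches (MulAut.conj : A →* MulAut A) {1} e) :
    ∀ i, e.1 (l i) = l i := by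
  induction hr with
  | base h => simp [Set.mem_singleton_iff.1 h]
  | @step e _ ih =>
    have key := fixes_of_conj_fixes hA hw hl (σ := (e⁻¹ : A))
      (fun a ha => mul_mem (mul_mem (e⁻¹).2 ha) (inv_mem (e⁻¹).2))
      (fun i => hXZ _ (inv_mem he) _) (fun a ha j => ?_)
    · intro i
      have h := congrArg e.1 (key i)
      simpa using h.symm
    · have h := ih (⟨a, ha⟩⁻¹) (mul_mem (inv_mem he) (hX.conj_mem e he _)) j
      have h2 : a⁻¹ * (((e⁻¹ : A) : MulAut G) * a * ((e⁻¹ : A) : MulAut G)⁻¹) =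
          (((e⁻¹ * MulAut.conj (⟨a, ha⟩⁻¹ : A) e : A) : MulAut G))⁻¹ := by
        simp [mul_assoc]
      rw [h2, MulAut.inv_apply, MulEquiv.symm_apply_eq]
      exact h.symm

end Words

/-! ### The hypercentral residual and its transversal -/

section Residual

variable {G : Type u} [Group G] {A : Subgroup (MulAut G)} (hA : NormalizedByInn A.subtype)

/-- The subgroup `[T, A]`. -/
def actionCommutator (A : Subgroup (MulAut G)) (T : Subgroup G) : Subgroup G :=
  Subgroup.closure {g | ∃ y ∈ T, ∃ a ∈ A, y⁻¹ * a y = g}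

theorem actionCommutator_le_comap {T : Subgroup G} {σ : MulAut G} (hσA : ∀ a ∈ A, σ * a * σ⁻¹ ∈ A)
    (hσT : ∀ y ∈ T, σ y ∈ T) :
    actionCommutator A T ≤ (actionCommutator A T).comap ((σ : G ≃* G) : G →* G) := by
  refine (Subgroup.closure_le _).2 ?_
  rintro _ ⟨y, hy, a, ha, rfl⟩
  refine Subgroup.subset_closure ⟨σ y, hσT y hy, _, hσA a ha, ?_⟩
  simp [MulAut.mul_apply]

/-- There is a smallest normal `A`-subgroup above the hypercenter with hypercentral quotient. -/
theorem exists_residual [(actionHypercenter A.subtype hA).FiniteIndex] :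
    ∃ T : NormalInvariant A.subtype, (∀ g, Reaches A.subtype T.toSubgroup g) ∧
      T.toSubgroup ≤ actionCommutator A T.toSubgroup ⊔ actionHypercenter A.subtype hA := by
  set Z := actionHypercenter A.subtype hA with hZ
  have hZn : Z.Normal := actionHypercenter_normal A.subtype hA
  have hZi : IsInvariant A.subtype Z := actionHypercenter_invariant A.subtype hA
  let S : Set (NormalInvariant A.subtype) :=
    {T | Z ≤ T.toSubgroup ∧ ∀ g, Reaches A.subtype T.toSubgroup g}
  have hS : S.Nonempty := ⟨⟨⊤, inferInstance, fun _ _ _ => Subgroup.mem_top _⟩, le_top,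
    fun g => .base (Subgroup.mem_top g)⟩
  let f : NormalInvariant A.subtype → ℕ := fun T => Z.relIndex T.toSubgroup
  let T := Function.argminOn f S hS
  have hT : T ∈ S := Function.argminOn_mem f S hS
  have := T.normal
  have hKT : actionCommutator A T.toSubgroup ≤ T.toSubgroup := by
    refine (Subgroup.closure_le _).2 ?_
    rintro _ ⟨y, hy, a, ha, rfl⟩
    exact mul_mem (inv_mem hy) (T.invariant ⟨a, ha⟩ y hy)
  have hKn : (actionCommutator A T.toSubgroup).Normal :=
    ⟨fun n hn g => actionCommutator_le_comap (σ := MulAut.conj g)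
      (fun a ha => conj_mem_of_normalizedByInn hA g ha)
      (fun y hy => T.normal.conj_mem y hy g) hn⟩
  have hKi : IsInvariant A.subtype (actionCommutator A T.toSubgroup) := fun a x hx =>
    actionCommutator_le_comap (σ := a.1)
      (fun b hb => mul_mem (mul_mem a.2 hb) (inv_mem a.2)) (fun y hy => T.invariant a y hy) hx
  let T' : NormalInvariant A.subtype :=
    { toSubgroup := actionCommutator A T.toSubgroup ⊔ Z
      normal := inferInstance
      invariant := fun a => by
        change actionCommutator A T.toSubgroup ⊔ Z ≤ Subgroup.comap ((a.1 : G ≃* G) : G →* G)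
          (actionCommutator A T.toSubgroup ⊔ Z)
        refine sup_le (fun x hx => ?_) fun x hx => ?_
        · exact Subgroup.mem_sup_left (hKi a x hx)
        · exact Subgroup.mem_sup_right (hZi a x hx) }
  -- One further commutator takes `T` into `[T, A]`, so `T'` also competes for the minimum;
  -- minimality forces `T' = T`.
  have hT' : T' ∈ S := ⟨le_sup_right, fun g => (hT.2 g).trans fun x hx => .step fun a =>
    .base (Subgroup.mem_sup_left (Subgroup.subset_closure ⟨x, hx, a.1, a.2, rfl⟩))⟩
  have hle : T'.toSubgroup ≤ T.toSubgroup := sup_le hKT hT.1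
  have hmin : f T ≤ f T' := Function.argminOn_le f S hT'
  have hmul : f T' * T'.toSubgroup.relIndex T.toSubgroup = f T :=
    Subgroup.relIndex_mul_relIndex _ _ _ hT'.1 hle
  have hpos : 0 < f T := Nat.pos_of_ne_zero
    (Subgroup.FiniteIndex.index_ne_zero (H := Z.subgroupOf T.toSubgroup))
  refine ⟨T, hT.2, Subgroup.relIndex_eq_one.1 ?_⟩
  change T'.toSubgroup.relIndex T.toSubgroup = 1
  have h1 : 0 < T'.toSubgroup.relIndex T.toSubgroup :=
    Nat.pos_of_ne_zero fun h => by rw [h, mul_zero] at hmul; omega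
  by_contra h
  have h2 : 2 ≤ T'.toSubgroup.relIndex T.toSubgroup := by omega
  nlinarith

theorem exists_word_of_mem {ι : Type v} {T N : Subgroup G} [N.Normal]
    (hN : IsInvariant A.subtype N) {x : ι → G} (hx : ∀ y ∈ T, ∃ j, (x j)⁻¹ * y ∈ N)
    (hT : ∀ y ∈ T, ∀ a ∈ A, a y ∈ T) {g : G} (hg : g ∈ actionCommutator A T) :
    ∃ w : List (ι × MulAut G), (∀ p ∈ w, p.2 ∈ A) ∧
      ((commWord w x : G) : G ⧸ N) = (g : G ⧸ N) := by
  have hgen : ∀ y ∈ T, ∀ a ∈ A, ∀ g : G, (∃ w : List (ι × MulAut G), (∀ p ∈ w, p.2 ∈ A) ∧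
      ((commWord w x : G) : G ⧸ N) = (g : G ⧸ N)) →
      ∃ w : List (ι × MulAut G), (∀ p ∈ w, p.2 ∈ A) ∧
        ((commWord w x : G) : G ⧸ N) = ((y⁻¹ * a y * g : G) : G ⧸ N) := by
    rintro y hy a ha g ⟨w, hw, hwg⟩
    obtain ⟨j, hj⟩ := hx y hy
    refine ⟨(j, a) :: w, ?_, ?_⟩
    · rintro p (_ | ⟨_, hp⟩)
      exacts [ha, hw p hp]
    · rw [commWord_cons]
      have h1 : ((x j : G) : G ⧸ N) = y := QuotientGroup.eq.2 hj
      have h2 := congrArg (quotientAction A.subtype N hN ⟨a, ha⟩) h1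
      have h3 : ((a (x j) : G) : G ⧸ N) = (a y : G) := h2
      exact congrArg₂ (· * ·) (congrArg₂ (· * ·) (congrArg (·⁻¹) h1) h3) hwg
  induction hg using Subgroup.closure_induction_left with
  | one => exact ⟨[], by simp, rfl⟩
  | mul_left _ hs g _ ih =>
    obtain ⟨y, hy, a, ha, rfl⟩ := hs
    exact hgen y hy a ha g ih
  | inv_mul_cancel _ hs g _ ih =>
    obtain ⟨y, hy, a, ha, rfl⟩ := hs
    have h := hgen (a y) (hT y hy a ha) a⁻¹ (inv_mem ha) g ih
    have h2 : (a y)⁻¹ * a⁻¹ (a y) = (y⁻¹ * a y)⁻¹ := by simp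
    rwa [h2] at h

/-- Coset representatives of the residual modulo the hypercenter that solve a system of commutator
equations. -/
theorem exists_fixed_transversal [(actionHypercenter A.subtype hA).FiniteIndex] :
    ∃ (ι : Type u) (_ : Finite ι) (w : ι → List (ι × MulAut G)) (l : ι → G),
      Nat.card ι ≤ (actionHypercenter A.subtype hA).index ∧ (∀ i, ∀ p ∈ w i, p.2 ∈ A) ∧
      (∀ i, commWord (w i) l = l i) ∧
      ∀ g, Reaches A.subtype {y | ∃ i, (l i)⁻¹ * y ∈ actionHypercenter A.subtype hA} g := by
  obtain ⟨T, hTr, hT⟩ := exists_residual hA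
  set Z := actionHypercenter A.subtype hA with hZ
  have hZn : Z.Normal := actionHypercenter_normal A.subtype hA
  have hZi : IsInvariant A.subtype Z := actionHypercenter_invariant A.subtype hA
  let x : T.toSubgroup ⧸ Z.subgroupOf T.toSubgroup → G := fun j => (j.out : G)
  have hx : ∀ y ∈ T.toSubgroup, ∃ j, (x j)⁻¹ * y ∈ Z := fun y hy =>
    ⟨((⟨y, hy⟩ : T.toSubgroup) : T.toSubgroup ⧸ Z.subgroupOf T.toSubgroup),
      (QuotientGroup.eq (s := Z.subgroupOf T.toSubgroup)).1 (QuotientGroup.out_eq' _)⟩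
  have hword : ∀ i, ∃ w : List ((T.toSubgroup ⧸ Z.subgroupOf T.toSubgroup) × MulAut G),
      (∀ p ∈ w, p.2 ∈ A) ∧ (x i)⁻¹ * commWord w x ∈ Z := by
    intro i
    obtain ⟨k, hk, z, hz, hkz⟩ := Subgroup.mem_sup_of_normal_right.1 (hT i.out.2)
    obtain ⟨w, hw, hwk⟩ := exists_word_of_mem hZi hx
      (fun y hy a ha => T.invariant ⟨a, ha⟩ y hy) hk
    refine ⟨w, hw, QuotientGroup.eq.1 ?_⟩
    rw [hwk]
    exact (QuotientGroup.eq.2 (by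
      change k⁻¹ * (i.out : G) ∈ Z
      rw [← hkz]; simpa using hz)).symm
  choose w hw hwx using hword
  obtain ⟨l, hl, hxl⟩ := exists_commWord_fixed hA hw hwx
  refine ⟨_, inferInstance, w, l, ?_, hw, hl, fun g => (hTr g).trans fun y hy => .base ?_⟩
  · exact Nat.le_of_dvd (Nat.pos_of_ne_zero Subgroup.FiniteIndex.index_ne_zero)
      (Subgroup.relIndex_dvd_index_of_normal Z T.toSubgroup)
  · obtain ⟨j, hj⟩ := hx y hy
    refine ⟨j, ?_⟩
    have h := mul_mem (inv_mem (hxl j)) hj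
    simpa [mul_assoc] using h

end Residual

/-! ### A quantitative Schur theorem -/

section Schur

open scoped commutatorElement

variable {K : Type u} [Group K]

/-- A commutator depends only on the cosets of its two entries modulo the center. -/
theorem commutatorSet_card_le [(Subgroup.center K).FiniteIndex] :
    Finite (commutatorSet K) ∧
      Nat.card (commutatorSet K) ≤ (Subgroup.center K).index * (Subgroup.center K).index := by
  have hsub : commutatorSet K ⊆ Set.range
      fun q : (K ⧸ Subgroup.center K) × (K ⧸ Subgroup.center K) => ⁅q.1.out, q.2.out⁆ := by
    rintro _ ⟨g, h, rfl⟩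
    refine ⟨(g, h), ?_⟩
    have hout : ∀ x : K, ∃ z ∈ Subgroup.center K, (x : K ⧸ Subgroup.center K).out = x * z :=
      fun x => ⟨x⁻¹ * (x : K ⧸ Subgroup.center K).out,
        QuotientGroup.eq.1 (QuotientGroup.out_eq' (x : K ⧸ Subgroup.center K)).symm, by group⟩
    obtain ⟨y, hy, hgy⟩ := hout g
    obtain ⟨z, hz, hhz⟩ := hout h
    change ⁅(g : K ⧸ Subgroup.center K).out, (h : K ⧸ Subgroup.center K).out⁆ = ⁅g, h⁆
    rw [hgy, hhz, commutatorElement_def, commutatorElement_def]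
    rw [Subgroup.mem_center_iff] at hy hz
    calc g * y * (h * z) * (g * y)⁻¹ * (h * z)⁻¹
        = g * (y * h) * (z * (y⁻¹ * g⁻¹)) * z⁻¹ * h⁻¹ := by group
      _ = g * h * g⁻¹ * h⁻¹ := by rw [← hy h, ← hz (y⁻¹ * g⁻¹)]; group
  have hfin : (commutatorSet K).Finite := (Set.finite_range _).subset hsub
  refine ⟨hfin.to_subtype, ?_⟩
  rw [Nat.card_coe_set_eq]
  refine (Set.ncard_le_ncard hsub (Set.finite_range _)).trans ?_
  rw [← Nat.card_coe_set_eq]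
  refine (Finite.card_range_le _).trans ?_
  rw [Nat.card_prod]
  exact le_rfl

/-- A bound for the order of a group generated by `m` elements whose center has index at most `t`
and whose generators have order dividing `t` modulo the commutator subgroup. -/
def orderBound (t m : ℕ) : ℕ := t ^ (t * (t * t) + 1) * t ^ m

theorem card_le_orderBound {t m : ℕ} [hc : (Subgroup.center K).FiniteIndex]
    (ht : (Subgroup.center K).index ≤ t) {s : Set K} (hs : s.Finite) (hsm : s.ncard ≤ m)
    (hgen : Subgroup.closure s = ⊤) (hpow : ∀ x ∈ s, x ^ t ∈ commutator K) :
    Finite K ∧ Nat.card K ≤ orderBound t m := by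
  have ht0 : 0 < t := (Nat.pos_of_ne_zero hc.index_ne_zero).trans_le ht
  obtain ⟨hfin, hcs⟩ := commutatorSet_card_le (K := K)
  have hcomm : Nat.card (commutator K) ≤ t ^ (t * (t * t) + 1) := by
    have h := Nat.le_of_dvd (pow_pos (Nat.pos_of_ne_zero hc.index_ne_zero) _)
      (Subgroup.card_commutator_dvd_index_center_pow K)
    refine h.trans ((Nat.pow_le_pow_left ht _).trans (Nat.pow_le_pow_right ht0 ?_))
    exact Nat.succ_le_succ (Nat.mul_le_mul ht (hcs.trans (Nat.mul_le_mul ht ht)))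
  have hab : ∀ x y : K ⧸ commutator K, x * y = y * x := (inferInstance :
    CommGroup (Abelianization K)).mul_comm
  obtain ⟨hqfin, hqcard⟩ := card_le_of_commutative hab
    (s := QuotientGroup.mk' (commutator K) '' s) (hs.image _) (by
      rw [← MonoidHom.map_closure, hgen]
      exact Subgroup.map_top_of_surjective _ (QuotientGroup.mk'_surjective _)) ht0 (by
      rintro _ ⟨x, hx, rfl⟩
      exact (QuotientGroup.eq_one_iff _).2 (hpow x hx))
  have hcard := Subgroup.card_mul_index (commutator K)
  have hidx : (commutator K).index ≤ t ^ m :=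
    hqcard.trans (Nat.pow_le_pow_right ht0 ((Set.ncard_image_le hs).trans hsm))
  refine ⟨Nat.finite_of_card_ne_zero ?_, ?_⟩
  · rw [← hcard]
    exact mul_ne_zero Nat.card_pos.ne' (Nat.card_pos (α := K ⧸ commutator K)).ne'
  · rw [← hcard]
    exact Nat.mul_le_mul hcomm hidx

end Schur

/-! ### The hypercenter of `A` -/

section OuterHypercenter

variable {G : Type u} [Group G] {A : Subgroup (MulAut G)}

/-- Conjugation carries `[z, b]` to the commutator of the corresponding inner automorphism with `b`.
-/
theorem reaches_conj_of_eq_conj {z : G} (h : Reaches A.subtype {1} z) :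
    ∀ a : A, a.1 = MulAut.conj z → Reaches (MulAut.conj : A →* MulAut A) {1} a := by
  induction h with
  | base h =>
    intro a ha
    rw [Set.mem_singleton_iff.1 h, map_one] at ha
    exact .base (Subtype.ext ha)
  | @step z _ ih =>
    intro a ha
    refine .step fun b => ih b _ ?_
    ext x
    simp [ha, MulAut.mul_apply, mul_assoc]

theorem reaches_conjNormal_iff {B : Type v} [Group B] {H : Subgroup B} [H.Normal] {S : Set B}
    (h : H) :
    Reaches (MulAut.conjNormal : B →* MulAut H) (Subtype.val ⁻¹' S) h ↔
      Reaches (MulAut.conj : B →* MulAut B) S (h : B) := by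
  have hcomm : ∀ (h : H) (b : B), ((h⁻¹ * MulAut.conjNormal b h : H) : B) =
      (h : B)⁻¹ * MulAut.conj b (h : B) := fun h b => by simp
  constructor
  · intro hr
    induction hr with
    | base hx => exact .base hx
    | step _ ih => exact .step fun b => hcomm _ b ▸ ih b
  · intro hr
    generalize hx : (h : B) = x at hr
    induction hr generalizing h with
    | base hS => exact .base (by rwa [Set.mem_preimage, hx])
    | step _ ih =>
      subst hx
      exact .step fun b => ih b _ (hcomm h b)

/-- If the hypercenter of `G` and the hypercenter of the outer action have bounded index, then so
does the hypercenter of `A`. -/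
theorem index_hypercenter_le (hA : NormalizedByInn A.subtype) {t k : ℕ}
    [(actionHypercenter A.subtype hA).FiniteIndex]
    (ht : (actionHypercenter A.subtype hA).index ≤ t)
    [(hypercenter (A ⧸ (inn G).subgroupOf A)).FiniteIndex]
    (hk : (hypercenter (A ⧸ (inn G).subgroupOf A)).index ≤ k) :
    (hypercenter A).FiniteIndex ∧ (hypercenter A).index ≤ indexBound t k * k := by
  set Z := actionHypercenter A.subtype hA with hZ
  have hZn : Z.Normal := actionHypercenter_normal A.subtype hA
  let D : Subgroup A := (inn G).subgroupOf A
  have hDn : D.Normal := inferInstance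
  have hHn : (hypercenter (A ⧸ D)).Normal := actionHypercenter_normal _ _
  let H : Subgroup A := (hypercenter (A ⧸ D)).comap (QuotientGroup.mk' D)
  have hHr : ∀ h : H, Reaches (MulAut.conj : A →* MulAut A) D (h : A) := fun h =>
    (mk_mem_hypercenter_iff D h.1).1 h.2
  have hHidx : H.index = (hypercenter (A ⧸ D)).index :=
    Subgroup.index_comap_of_surjective _ (QuotientGroup.mk'_surjective D)
  have hHfi : H.FiniteIndex := ⟨hHidx ▸ Subgroup.FiniteIndex.index_ne_zero⟩
  let ψ : A →* MulAut H := MulAut.conjNormal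
  have hψ : NormalizedByInn ψ := NormalizedByInn.of_exists_conj fun g b =>
    ⟨g * b * g⁻¹, fun x => Subtype.ext (by simp [ψ, mul_assoc])⟩
  have hLi : IsInvariant ψ (D.subgroupOf H) := fun b x hx => by
    rw [Subgroup.mem_subgroupOf] at hx ⊢
    simpa [ψ] using hDn.conj_mem _ hx b
  have hone : (Subtype.val ⁻¹' ({1} : Set A) : Set H) = {1} := by ext; simp
  have hYr : ∀ h : H, h ∈ actionHypercenter ψ hψ ↔
      Reaches (MulAut.conj : A →* MulAut A) {1} (h : A) := fun h => by
    rw [mem_actionHypercenter_iff, ← reaches_conjNormal_iff, hone]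
  choose c hc using fun l : D.subgroupOf H => l.2
  obtain ⟨hrel, hrel'⟩ := index_le_card_of_map
    ((actionHypercenter ψ hψ).subgroupOf (D.subgroupOf H)) (fun l => (c l : G ⧸ Z)) (by
      intro a b hab
      rw [Subgroup.mem_subgroupOf, hYr]
      refine reaches_conj_of_eq_conj
        ((mem_actionHypercenter_iff A.subtype hA).1 (QuotientGroup.eq.1 hab)) _ ?_
      rw [map_mul, map_inv, hc, hc]
      rfl)
  -- The bound of (H) for `A` acting on `H` by conjugation, with `D = A ∩ Inn(G)` as the subgroup
  -- having hypercentral quotient. `D` may be infinite, but its hypercentral part has index at most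
  -- `t`. Elements of `H` act on `H` as inner automorphisms.
  obtain ⟨hYfi, hYidx⟩ := index_actionHypercenter_le hψ hLi
    (fun h => (reaches_conjNormal_iff h).2 (hHr h)) H
    (fun h hh => .base ⟨⟨h, hh⟩, by ext x; simp [ψ]⟩) (hrel'.trans ht) hrel.index_ne_zero
    (hHidx.le.trans hk)
  have hle : (actionHypercenter ψ hψ).map H.subtype ≤ hypercenter A := by
    rintro _ ⟨h, hh, rfl⟩
    exact (mem_actionHypercenter_iff _ _).2 ((hYr h).1 hh)
  have hidx := Subgroup.index_map_subtype (actionHypercenter ψ hψ)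
  have hfi : ((actionHypercenter ψ hψ).map H.subtype).FiniteIndex :=
    ⟨hidx ▸ mul_ne_zero hYfi.index_ne_zero hHfi.index_ne_zero⟩
  refine ⟨Subgroup.finiteIndex_of_le hle, ?_⟩
  refine (Nat.le_of_dvd (Nat.pos_of_ne_zero hfi.index_ne_zero)
    (Subgroup.index_dvd_of_le hle)).trans ?_
  rw [hidx]
  exact Nat.mul_le_mul hYidx (hHidx.le.trans hk)

end OuterHypercenter

/-! ### Finiteness of the normal closure of the solution -/

section Orbit

variable {G : Type u} [Group G] {A : Subgroup (MulAut G)} {ι : Type v}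

theorem IsInvariant.commutator {L : Subgroup G} (hL : IsInvariant A.subtype L) :
    IsInvariant A.subtype ⁅L, L⁆ := by
  intro a x hx
  have h : ⁅L, L⁆.map ((a.1 : G ≃* G) : G →* G) = ⁅L, L⁆ := by
    rw [Subgroup.map_commutator]
    exact congrArg₂ _ (hL.map_eq a) (hL.map_eq a)
  exact h ▸ ⟨x, hx, rfl⟩

/-- Modulo the commutator subgroup, powers may be taken inside words of commutators. -/
theorem mk_commWord_pow {L : Subgroup G} [L.Normal] {l : ι → G} {w : List (ι × MulAut G)}
    (hl : ∀ i, l i ∈ L) (hw : ∀ p ∈ w, ∀ i, p.2 (l i) ∈ L) (t : ℕ) :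
    ((commWord w (fun i => l i ^ t) : G) : G ⧸ ⁅L, L⁆) = ((commWord w l ^ t : G) : G ⧸ ⁅L, L⁆) := by
  have hcomm : ∀ x ∈ L, ∀ y ∈ L, Commute (x : G ⧸ ⁅L, L⁆) (y : G ⧸ ⁅L, L⁆) := by
    intro x hx y hy
    refine QuotientGroup.eq.2 ?_
    have h := Subgroup.commutator_mem_commutator (inv_mem hy) (inv_mem hx)
    rw [commutatorElement_def] at h
    simpa [mul_assoc] using h
  have hmem : ∀ v : List (ι × MulAut G), (∀ p ∈ v, ∀ i, p.2 (l i) ∈ L) → commWord v l ∈ L := by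
    intro v hv
    refine Subgroup.list_prod_mem _ fun x hx => ?_
    obtain ⟨p, hp, rfl⟩ := List.mem_map.1 hx
    exact mul_mem (inv_mem (hl _)) (hv p hp _)
  induction w with
  | nil => simp [commWord]
  | cons p w ih =>
    have hp : p.2 (l p.1) ∈ L := hw p List.mem_cons_self _
    have hw' : ∀ q ∈ w, ∀ i, q.2 (l i) ∈ L := fun q hq => hw q (List.mem_cons_of_mem _ hq)
    rw [commWord_cons, commWord_cons, QuotientGroup.mk_pow, QuotientGroup.mk_mul _ _ (commWord w l),
      (hcomm _ (mul_mem (inv_mem (hl _)) hp) _ (hmem w hw')).mul_pow,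
      QuotientGroup.mk_mul _ _ (p.2 (l p.1)), (hcomm _ (inv_mem (hl _)) _ hp).mul_pow,
      ← QuotientGroup.mk_pow _ (commWord w l), ← ih hw', map_pow, ← inv_pow]
    rfl

variable (hA : NormalizedByInn A.subtype)

/-- A solution of the system modulo `K` sinks along the series: entries in `Z_{β+1} K` have
commutators in `Z_β K`, hence lie there themselves, down to `K`. -/
theorem mem_of_eq_commWord [Finite ι] {K : Subgroup G} [hKn : K.Normal]
    (hK : IsInvariant A.subtype K) {w : ι → List (ι × MulAut G)} (hw : ∀ i, ∀ p ∈ w i, p.2 ∈ A)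
    {y : ι → G} (hy : ∀ i, y i ∈ actionHypercenter A.subtype hA)
    (hyw : ∀ i, ((commWord (w i) y : G) : G ⧸ K) = (y i : G ⧸ K)) : ∀ i, y i ∈ K := by
  obtain ⟨α, hα⟩ := exists_centerSeries_eq A.subtype hA
  rw [← hα] at hy
  have hy' : ∀ i, y i ∈ (centerSeries A.subtype hA α).toSubgroup ⊔ K := fun i =>
    Subgroup.mem_sup_left (hy i)
  clear hα hy
  induction α using Ordinal.limitRecOn with
  | zero => simpa [centerSeries_zero] using hy'
  | add_one β ih =>
    refine ih fun i => ?_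
    have hmem : commWord (w i) y ∈ (centerSeries A.subtype hA β).toSubgroup ⊔ K := by
      refine Subgroup.list_prod_mem _ fun x hx => ?_
      obtain ⟨p, hp, rfl⟩ := List.mem_map.1 hx
      obtain ⟨z, hz, k, hk, hzk⟩ := Subgroup.mem_sup_of_normal_right.1 (hy' p.1)
      have h1 := (mem_centerSeries_succ A.subtype hA β z).1 hz ⟨p.2, hw i p hp⟩
      have h2 : (y p.1)⁻¹ * p.2 (y p.1) = k⁻¹ * (z⁻¹ * p.2 z) * p.2 k := by
        rw [← hzk, map_mul]; group
      rw [h2]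
      exact mul_mem (mul_mem (inv_mem (Subgroup.mem_sup_right hk)) (Subgroup.mem_sup_left h1))
        (Subgroup.mem_sup_right (hK ⟨p.2, hw i p hp⟩ k hk))
    have h := mul_mem hmem (Subgroup.mem_sup_right (QuotientGroup.eq.1 (hyw i)))
    simpa using h
  | limit l hl ih =>
    choose z hz k hk hzk using fun i => Subgroup.mem_sup_of_normal_right.1 (hy' i)
    obtain ⟨β, hβ, h⟩ := exists_lt_forall_mem_centerSeries hA hl hz
    exact ih β hβ fun i => hzk i ▸ mul_mem (Subgroup.mem_sup_left (h i))
      (Subgroup.mem_sup_right (hk i))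

/-- The set of all conjugates of images under `A` of the entries of `l`. -/
def orbitSet (A : Subgroup (MulAut G)) (l : ι → G) : Set G :=
  {x | ∃ (g : G) (a : A) (i : ι), x = g * a.1 (l i) * g⁻¹}

theorem closure_orbitSet_normal (l : ι → G) : (Subgroup.closure (orbitSet A l)).Normal := by
  refine ⟨fun n hn g => ?_⟩
  have h : Subgroup.closure (orbitSet A l) ≤
      (Subgroup.closure (orbitSet A l)).comap (MulAut.conj g : G ≃* G).toMonoidHom := by
    refine (Subgroup.closure_le _).2 ?_
    rintro _ ⟨g', a, i, rfl⟩
    exact Subgroup.subset_closure ⟨g * g', a, i, by simp [mul_assoc]⟩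
  exact h hn

theorem closure_orbitSet_invariant (l : ι → G) :
    IsInvariant A.subtype (Subgroup.closure (orbitSet A l)) := by
  intro b
  change Subgroup.closure (orbitSet A l) ≤
    (Subgroup.closure (orbitSet A l)).comap ((b.1 : G ≃* G) : G →* G)
  refine (Subgroup.closure_le _).2 ?_
  rintro _ ⟨g, a, i, rfl⟩
  exact Subgroup.subset_closure ⟨b.1 g, b * a, i, by simp [MulAut.mul_apply]⟩

theorem orbitSet_finite [Finite ι] {Z : Subgroup G} (hZi : IsInvariant A.subtype Z)
    [Z.FiniteIndex] {l : ι → G} (hZl : ∀ z ∈ Z, ∀ i, MulAut.conj z (l i) = l i) {X : Subgroup A}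
    [X.FiniteIndex] (hX : ∀ e ∈ X, ∀ i, e.1 (l i) = l i) :
    (orbitSet A l).Finite ∧ (orbitSet A l).ncard ≤ Z.index * X.index * Nat.card ι := by
  have hsub : orbitSet A l ⊆ Set.range fun q : ((G ⧸ Z) × (A ⧸ X)) × ι =>
      q.1.1.out * q.1.2.out.1 (l q.2) * q.1.1.out⁻¹ := by
    rintro _ ⟨g, a, i, rfl⟩
    refine ⟨((g, a), i), ?_⟩
    change (g : G ⧸ Z).out * (a : A ⧸ X).out.1 (l i) * (g : G ⧸ Z).out⁻¹ = _
    have ha : (a : A ⧸ X).out⁻¹ * a ∈ X :=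
      QuotientGroup.eq.1 (QuotientGroup.out_eq' (a : A ⧸ X))
    have hg : (g : G ⧸ Z).out⁻¹ * g ∈ Z :=
      QuotientGroup.eq.1 (QuotientGroup.out_eq' (g : G ⧸ Z))
    have h1 : (a : A ⧸ X).out.1 (l i) = a.1 (l i) := by
      have h := congrArg (a : A ⧸ X).out.1 (hX _ ha i)
      simpa [MulAut.mul_apply] using h.symm
    have h2 := congrArg a.1 (hZl _ (hZi a⁻¹ _ hg) i)
    rw [h1]
    generalize (g : G ⧸ Z).out = g' at h2
    simp only [map_mul, map_inv, Subgroup.subtype_apply] at h2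
    calc g' * a.1 (l i) * g'⁻¹ = g' * (g'⁻¹ * g * a.1 (l i) * (g'⁻¹ * g)⁻¹) * g'⁻¹ := by
          congr 2
          simpa [mul_assoc] using h2.symm
      _ = g * a.1 (l i) * g⁻¹ := by group
  have hfin := Set.finite_range fun q : ((G ⧸ Z) × (A ⧸ X)) × ι =>
      q.1.1.out * q.1.2.out.1 (l q.2) * q.1.1.out⁻¹
  refine ⟨hfin.subset hsub, (Set.ncard_le_ncard hsub hfin).trans ?_⟩
  rw [← Nat.card_coe_set_eq]
  refine (Finite.card_range_le _).trans ?_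
  rw [Nat.card_prod, Nat.card_prod]
  exact le_rfl

theorem exists_finite_residual [hfi : (actionHypercenter A.subtype hA).FiniteIndex]
    {X : Subgroup A} [X.Normal] [X.FiniteIndex]
    (hXZ : ∀ e ∈ X, ∀ g : G, g⁻¹ * e.1 g ∈ actionHypercenter A.subtype hA)
    (hXr : ∀ e ∈ X, Reaches (MulAut.conj : A →* MulAut A) {1} e) {t n : ℕ}
    (ht : (actionHypercenter A.subtype hA).index = t) (hn : X.index ≤ n) :
    ∃ (L : Subgroup G) (_ : L.Normal) (_ : IsInvariant A.subtype L),
      Finite L ∧ Nat.card L ≤ orderBound t (t * n * t) ∧ ∀ g, Reaches A.subtype L g := by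
  obtain ⟨ι, _, w, l, hι, hw, hl, hr⟩ := exists_fixed_transversal hA
  have hZl : ∀ z ∈ actionHypercenter A.subtype hA, ∀ i, MulAut.conj z (l i) = l i :=
    fun z hz => hypercenter_centralizes_fixed hA hw hl hz
  set Z := actionHypercenter A.subtype hA with hZ
  have hZn : Z.Normal := actionHypercenter_normal A.subtype hA
  have hZi : IsInvariant A.subtype Z := actionHypercenter_invariant A.subtype hA
  have hXl : ∀ e ∈ X, ∀ i, e.1 (l i) = l i := fun e he =>
    reaches_one_fixes hA hw hl hXZ he (hXr e he)
  set L := Subgroup.closure (orbitSet A l) with hLdef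
  have hLn : L.Normal := closure_orbitSet_normal l
  have hLi : IsInvariant A.subtype L := closure_orbitSet_invariant l
  have hlL : ∀ i, l i ∈ L := fun i => Subgroup.subset_closure ⟨1, 1, i, by simp⟩
  obtain ⟨hsfin, hscard⟩ := orbitSet_finite hZi hZl hXl
  have hKi := hLi.commutator
  -- The powers `(l i) ^ t` lie in `Z` and, as `L/[L, L]` is abelian, solve the same system modulo
  -- `[L, L]`.
  have hlK : ∀ i, l i ^ t ∈ ⁅L, L⁆ := by
    refine mem_of_eq_commWord hA hKi hw (fun i => ?_) fun i => ?_
    · rw [← ht]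
      exact Subgroup.pow_index_mem Z (l i)
    · rw [mk_commWord_pow hlL fun p hp j => hLi ⟨p.2, hw i p hp⟩ _ (hlL j), hl]
  have hsK : ∀ x ∈ orbitSet A l, x ^ t ∈ ⁅L, L⁆ := by
    rintro _ ⟨g, a, i, rfl⟩
    rw [conj_pow, ← map_pow]
    exact (inferInstance : ⁅L, L⁆.Normal).conj_mem _ (hKi a _ (hlK i)) g
  -- Hence `Z ∩ L` is central in `L`, so the center of `L` has index at most `t`.
  have hZL : L ≤ Subgroup.centralizer (Z : Set G) := by
    refine (Subgroup.closure_le _).2 ?_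
    rintro _ ⟨g, a, i, rfl⟩
    refine Subgroup.mem_centralizer_iff.2 fun z hz => ?_
    have hz' : g⁻¹ * z * g ∈ Z := by simpa using hZn.conj_mem z hz g⁻¹
    have h := congrArg a.1 (hZl _ (hZi a⁻¹ _ hz') i)
    simp only [map_mul, map_inv, Subgroup.subtype_apply] at h
    calc z * (g * a.1 (l i) * g⁻¹)
        = g * ((g⁻¹ * z * g) * a.1 (l i) * (g⁻¹ * z * g)⁻¹) * g⁻¹ * z := by group
      _ = g * a.1 (l i) * g⁻¹ * z := by
        congr 3
        simpa [mul_assoc] using h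
  have hcent : Z.subgroupOf L ≤ Subgroup.center L := fun z hz =>
    Subgroup.mem_center_iff.2 fun x => Subtype.ext
      (Subgroup.mem_centralizer_iff.1 (hZL x.2) z.1 hz).symm
  have hcfi : (Subgroup.center L).FiniteIndex := Subgroup.finiteIndex_of_le hcent
  have hcidx : (Subgroup.center L).index ≤ t := by
    refine (Nat.le_of_dvd (Nat.pos_of_ne_zero Subgroup.FiniteIndex.index_ne_zero)
      (Subgroup.index_dvd_of_le hcent)).trans ?_
    rw [← ht]
    exact Nat.le_of_dvd (Nat.pos_of_ne_zero Subgroup.FiniteIndex.index_ne_zero)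
      (Subgroup.relIndex_dvd_index_of_normal Z L)
  have hmem : orbitSet A l ⊆ Set.range (Subtype.val : L → G) := fun x hx =>
    ⟨⟨x, Subgroup.subset_closure hx⟩, rfl⟩
  obtain ⟨hLfin, hLcard⟩ := card_le_orderBound (K := L) (m := t * n * t) hcidx
    (s := Subtype.val ⁻¹' orbitSet A l) (hsfin.preimage Subtype.val_injective.injOn) (by
      rw [Set.ncard_preimage_of_injective_subset_range Subtype.val_injective hmem]
      refine hscard.trans ?_
      rw [ht] at hι ⊢
      exact Nat.mul_le_mul (Nat.mul_le_mul_left t hn) hι)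
    Subgroup.closure_closure_coe_preimage (fun x hx => by
      have h := hsK x.1 hx
      rw [← Subgroup.map_subtype_commutator] at h
      obtain ⟨y, hy, hyx⟩ := h
      have : y = x ^ t := Subtype.ext hyx
      exact this ▸ hy)
  refine ⟨L, hLn, hLi, hLfin, hLcard, fun g => (hr g).trans ?_⟩
  rintro y ⟨i, hi⟩
  have h := Reaches.mul_left hLi ((mem_actionHypercenter_iff A.subtype hA).1 hi) (l i) (hlL i)
  rwa [mul_inv_cancel_left] at h

end Orbit

/-! ### Assembling the bounds -/

/-- A bound for the order of the finite residual. -/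
def residualBound (t k : ℕ) : ℕ :=
  orderBound t (t * (indexBound t k * k * t ^ t) * t)

theorem exists_finite_residual_card_le {G : Type u} [Group G] {A : Subgroup (MulAut G)}
    (hA : NormalizedByInn A.subtype) {t k : ℕ}
    [(hypercenter (A ⧸ (inn G).subgroupOf A)).FiniteIndex]
    (hk : (hypercenter (A ⧸ (inn G).subgroupOf A)).index ≤ k)
    [hfi : (actionHypercenter A.subtype hA).FiniteIndex]
    (ht : (actionHypercenter A.subtype hA).index = t) :
    ∃ (L : Subgroup G) (_ : L.Normal) (_ : IsInvariant A.subtype L),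
      Finite L ∧ Nat.card L ≤ residualBound t k ∧ ∀ g, Reaches A.subtype L g := by
  obtain ⟨hHfi, hHidx⟩ := index_hypercenter_le hA ht.le hk
  have hZn := actionHypercenter_normal A.subtype hA
  have hZi := actionHypercenter_invariant A.subtype hA
  have htop : IsInvariant (quotientAction A.subtype _ hZi) ⊤ := fun _ _ _ => Subgroup.mem_top _
  obtain ⟨hCfi, hCidx⟩ := pointwiseFixer_index_le htop
  have hCn := pointwiseFixer_normal htop
  have hHn : (hypercenter A).Normal := actionHypercenter_normal _ _
  rw [Subgroup.card_top, ← Subgroup.index_eq_card, ht] at hCidx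
  -- The second factor is the kernel of `A` on `G/Z`, of index at most `t ^ t` since `|G/Z| = t`.
  refine exists_finite_residual hA
    (X := hypercenter A ⊓ pointwiseFixer (quotientAction A.subtype _ hZi) ⊤)
    (fun e he g => ?_) (fun e he => (mem_actionHypercenter_iff _ _).1 he.1) ht
    (Subgroup.index_inf_le.trans (Nat.mul_le_mul hHidx hCidx))
  exact QuotientGroup.eq.1 (he.2 (g : G ⧸ _) (Subgroup.mem_top _)).symm

end ActionHypercenter

theorem theorem2 :
    (∃ f : ℕ → ℕ → ℕ,
      ∀ (G : Type u) [Group G] (A : Subgroup (MulAut G)) (hA : NormalizedByInn A.subtype)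
        (t k : ℕ),
        (hypercenter (A ⧸ (inn G).subgroupOf A)).FiniteIndex →
        (hypercenter (A ⧸ (inn G).subgroupOf A)).index = k →
        (actionHypercenter A.subtype hA).FiniteIndex →
        (actionHypercenter A.subtype hA).index = t →
        ∃ (L : Subgroup G) (_ : L.Normal) (hL : IsInvariant A.subtype L),
          Finite L ∧ Nat.card L ≤ f t k ∧
          IsActionHypercentral (quotientAction A.subtype L hL) (hA.quotientAction L hL)) ∧
    (∃ f : ℕ → ℕ → ℕ,
      ∀ (G : Type u) [Group G] (A : Subgroup (MulAut G)) (hA : NormalizedByInn A.subtype)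
        (d k : ℕ),
        (hypercenter (A ⧸ (inn G).subgroupOf A)).FiniteIndex →
        (hypercenter (A ⧸ (inn G).subgroupOf A)).index = k →
        ∀ (L : Subgroup G) [L.Normal] (hL : IsInvariant A.subtype L),
          Finite L → Nat.card L = d →
          IsActionHypercentral (quotientAction A.subtype L hL) (hA.quotientAction L hL) →
          (actionHypercenter A.subtype hA).FiniteIndex ∧
          (actionHypercenter A.subtype hA).index ≤ f d k) := by
  refine ⟨⟨residualBound, ?_⟩, ⟨indexBound, ?_⟩⟩
  · intro G _ A hA t k _ hk _ ht
    obtain ⟨L, hLn, hLi, hfin, hcard, hr⟩ := exists_finite_residual_card_le hA hk.le ht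
    exact ⟨L, hLn, hLi, hfin, hcard, (isActionHypercentral_quotient_iff hA L hLi).2 hr⟩
  · intro G _ A hA d k hfi hk L _ hL _ hd hc
    have hidx := Subgroup.index_comap_of_surjective (hypercenter (A ⧸ (inn G).subgroupOf A))
      (QuotientGroup.mk'_surjective ((inn G).subgroupOf A))
    have hHfi : ((hypercenter (A ⧸ (inn G).subgroupOf A)).comap
        (QuotientGroup.mk' ((inn G).subgroupOf A))).FiniteIndex :=
      ⟨hidx ▸ hfi.index_ne_zero⟩
    have hrel : (actionHypercenter A.subtype hA).relIndex L ∣ d :=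
      hd ▸ Subgroup.index_dvd_card _
    have hdpos : 0 < d := hd ▸ Nat.card_pos
    exact index_actionHypercenter_le hA hL ((isActionHypercentral_quotient_iff hA L hL).1 hc) _
      (fun h hh => (mk_mem_hypercenter_iff ((inn G).subgroupOf A) h).1 hh)
      (Nat.le_of_dvd hdpos hrel) (fun h => hdpos.ne' (zero_dvd_iff.1 (h ▸ hrel)))
      (hidx.le.trans hk.le)
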